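/- **Theorem 3.** For a real-valued cost function $C$ on $\{0,1\}^n$ (the total weight of violated constraints) and $\beta,\gamma\in\mathbb R$, the 1-step QAOA prepares $$|\psi_{\beta,\gamma}\rangle = e^{i\beta B}e^{i\gamma C}\,2^{-n/2}\sum_{x\in\{0,1\}^n}|x\rangle ,\qquad B=\sum_{j=1}^n X_j,\quad C|x\rangle=C(x)|x\rangle ,$$ and measures it in the computational basis. Fix an integer $\ell\ge 1$, constants $\alpha_1,\alpha_2>0$, a bound $L\ge 0$, and a finite family of non-negative integers $a_\mu,b_\mu,c_\mu,d_\mu$ with $a_\mu+b_\mu+c_\mu+d_\mu=\ell$ and reals $\kappa_\mu$; put $$f(\xi_1,\xi_2)=\sum_\mu\kappa_\mu\,\xi_1^{a_\mu}(1-\xi_1)^{b_\mu}\xi_2^{c_\mu}(1-\xi_2)^{d_\mu}.$$ Consider a sequence of CSP instances with $n=n_1+n_2\to\infty$ and $n_i=\alpha_i n$. Each consists of a planted string $s\in\{0,1\}^{n_1}\times\{0,1\}^{n_2}$ and a cost function $C$ such that $C(x)\ge C(s)$ for all $x$; $C$ is $S_{n_1}\times S_{n_2}$-symmetric relative to $s$,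 i.e. $C(\pi(x\oplus s)\oplus s)=C(x)$ for all $x$ and all permutations $\pi$ of the bits preserving the two blocks; $C$ is a sum of clauses each depending on at most $L$ bits ($L$ independent of $n$); and, with $k_i$ the Hamming distance between $x$ and $s$ on the $i$-th block, $$C(x)=n^{\ell}f(k_1/n_1,k_2/n_2)+O(n^{\ell-1})\quad\text{uniformly in } x .$$ Assume further $$\frac1{\alpha_1}\sum_\mu\kappa_\mu(a_\mu-b_\mu)=\frac1{\alpha_2}\sum_\mu\kappa_\mu(c_\mu-d_\mu)\ne 0$$ and $$\det\begin{pmatrix}4\alpha_1+i\pi\alpha_1\frac{\sum_\mu\kappa_\mu[(a_\mu-b_\mu)^2-(a_\mu+b_\mu)]}{\sum_\mu\kappa_\mu(a_\mu-b_\mu)} & i\pi\alpha_1\frac{\sum_\mu\kappa_\mu(a_\mu-b_\mu)(c_\mu-d_\mu)}{\sum_\mu\kappa_\mu(a_\mu-b_\mu)}\\ i\pi\alpha_1\frac{\sum_\mu\kappa_\mu(a_\mu-b_\mu)(c_\mu-d_\mu)}{\sum_\mu\kappa_\mu(a_\mu-b_\mu)} & 4\alpha_2+i\pi\alpha_2\frac{\sum_\mu\kappa_\mu[(c_\mu-d_\mu)^2-(c_\mu+d_\mu)]}{\sum_\mu\kappa_\mu(c_\mu-d_\mu)}\end{pmatrix}\ne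 0 .$$ Let $\Gamma=-2^{\ell-2}\alpha_1\big/\sum_\mu\kappa_\mu(a_\mu-b_\mu)$, let $H(\xi)=-\xi\log\xi-(1-\xi)\log(1-\xi)$, $$S(\xi_1,\xi_2)=\sum_{i=1}^2\Big[\alpha_iH(\xi_i)+\tfrac{i\pi}{2}\alpha_i\xi_i\Big]-\log 2+i\pi\Gamma f(\xi_1,\xi_2),$$ and let $H_S$ be the Hessian matrix of $S$ at $(1/2,1/2)$. Then with $\beta=-\pi/4$ and $\gamma=-\Gamma\pi/n^{\ell-1}$, which is $\Theta(1/n^{\ell-1})$, the 1-step QAOA outputs the planted string $s$ with probability $\Omega(1)$, and $$\lim_{n\to\infty}\big|\langle s|\psi_{\beta,\gamma}\rangle\big|^2=\frac{16\,\alpha_1\alpha_2}{|\det H_S|}.$$ -/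

import Mathlib

namespace QAOA

/-! ### Bit strings and constraint satisfaction problems -/

/-- Bit strings indexed by `ι`; the sum in `ZMod 2` is the bitwise exclusive or. -/
abbrev BitString (ι : Type) : Type := ι → ZMod 2

/-- `C` is invariant under the group `G` of bit permutations relative to `s`:
`C (π (x ⊕ s) ⊕ s) = C x`, where `[π x]_i = x_{π i}`. -/
def IsSymmetricRel {ι : Type} (G : Subgroup (Equiv.Perm ι)) (s : BitString ι)
    (C : BitString ι → ℝ) : Prop :=
  ∀ π ∈ G, ∀ x : BitString ι, C ((fun i => (x + s) (π i)) + s) = C x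

/-- `S_{n₁} × S_{n₂}`, as the permutations of the `n₁ + n₂` bits that act on each block
separately. -/
def productSymmetry (n₁ n₂ : ℕ) : Subgroup (Equiv.Perm (Fin n₁ ⊕ Fin n₂)) :=
  (Equiv.Perm.sumCongrHom (Fin n₁) (Fin n₂)).range

/-- The planted string `s` minimizes the cost. -/
def IsPlanted {ι : Type} (s : BitString ι) (C : BitString ι → ℝ) : Prop :=
  ∀ x, C s ≤ C x

/-- `C` is the cost function of a Max-`L`-CSP: a sum of finitely many clauses, each of which
depends on at most `L` bits. -/
def IsLocal {ι : Type} (L : ℕ) (C : BitString ι → ℝ) : Prop :=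
  ∃ (N : ℕ) (clause : Fin N → BitString ι → ℝ),
    (∀ j, ∃ T : Finset ι, T.card ≤ L ∧ DependsOn (clause j) (T : Set ι)) ∧
    ∀ x, C x = ∑ j, clause j x

/-- Hamming distance on the first block of bits. -/
def dist₁ {n₁ n₂ : ℕ} (x s : BitString (Fin n₁ ⊕ Fin n₂)) : ℕ :=
  hammingDist (fun i => x (Sum.inl i)) (fun i => s (Sum.inl i))

/-- Hamming distance on the second block of bits. -/
def dist₂ {n₁ n₂ : ℕ} (x s : BitString (Fin n₁ ⊕ Fin n₂)) : ℕ :=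
  hammingDist (fun i => x (Sum.inr i)) (fun i => s (Sum.inr i))

/-! ### The one-step QAOA -/

section Circuit

variable {ι : Type} [Fintype ι] [DecidableEq ι]

/-- Pauli `X` on bit `j`, which maps `|x⟩` to `|x ⊕ e_j⟩`. -/
def pauliX (j : ι) : Matrix (BitString ι) (BitString ι) ℂ :=
  fun y x => if y = x + Pi.single j 1 then 1 else 0

/-- The mixer `B = ∑_j X_j`. -/
def mixer (ι : Type) [Fintype ι] [DecidableEq ι] : Matrix (BitString ι) (BitString ι) ℂ :=
  ∑ j : ι, pauliX j

/-- The cost operator `C |x⟩ = C(x) |x⟩`. -/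
def costOperator (C : BitString ι → ℝ) : Matrix (BitString ι) (BitString ι) ℂ :=
  Matrix.diagonal fun x => (C x : ℂ)

/-- The uniform superposition `2^{-n/2} ∑_x |x⟩`. -/
noncomputable def uniformState (ι : Type) [Fintype ι] : BitString ι → ℂ :=
  fun _ => ((1 / Real.sqrt (2 ^ Fintype.card ι) : ℝ) : ℂ)

/-- The state `e^{iβB} e^{iγC} |+⟩^{⊗n}` prepared by the one-step QAOA. -/
noncomputable def state (C : BitString ι → ℝ) (β γ : ℝ) : BitString ι → ℂ :=
  Matrix.mulVec (NormedSpace.exp ((Complex.I * (β : ℂ)) • mixer ι))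
    (Matrix.mulVec (NormedSpace.exp ((Complex.I * (γ : ℂ)) • costOperator C)) (uniformState ι))

/-- The probability that measuring the one-step QAOA state yields the bit string `x`. -/
noncomputable def outcomeProb (C : BitString ι → ℝ) (β γ : ℝ) (x : BitString ι) : ℝ :=
  ‖state C β γ x‖ ^ 2

end Circuit

/-! ### The leading-order form of the cost -/

/-- The data `(a_μ, b_μ, c_μ, d_μ, κ_μ)` of the leading-order polynomial, with
`a_μ + b_μ + c_μ + d_μ = ℓ`. -/
structure LeadingForm (ℓ : ℕ) where
  /-- number of terms -/
  terms : ℕ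
  /-- exponents of `ξ₁` -/
  a : Fin terms → ℕ
  /-- exponents of `1 - ξ₁` -/
  b : Fin terms → ℕ
  /-- exponents of `ξ₂` -/
  c : Fin terms → ℕ
  /-- exponents of `1 - ξ₂` -/
  d : Fin terms → ℕ
  /-- coefficients -/
  κ : Fin terms → ℝ
  /-- every term has total degree `ℓ` -/
  total : ∀ μ, a μ + b μ + c μ + d μ = ℓ

namespace LeadingForm

variable {ℓ : ℕ} (F : LeadingForm ℓ)

/-- `f(ξ₁, ξ₂) = ∑_μ κ_μ ξ₁^{a_μ} (1-ξ₁)^{b_μ} ξ₂^{c_μ} (1-ξ₂)^{d_μ}`. -/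
def f (ξ₁ ξ₂ : ℝ) : ℝ :=
  ∑ μ, F.κ μ * ξ₁ ^ F.a μ * (1 - ξ₁) ^ F.b μ * ξ₂ ^ F.c μ * (1 - ξ₂) ^ F.d μ

/-- `∑_μ κ_μ (a_μ - b_μ)`. -/
def g₁ : ℝ := ∑ μ, F.κ μ * ((F.a μ : ℝ) - F.b μ)

/-- `∑_μ κ_μ (c_μ - d_μ)`. -/
def g₂ : ℝ := ∑ μ, F.κ μ * ((F.c μ : ℝ) - F.d μ)

/-- `∑_μ κ_μ [(a_μ - b_μ)² - (a_μ + b_μ)]`. -/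
def h₁₁ : ℝ := ∑ μ, F.κ μ * (((F.a μ : ℝ) - F.b μ) ^ 2 - ((F.a μ : ℝ) + F.b μ))

/-- `∑_μ κ_μ (a_μ - b_μ) (c_μ - d_μ)`. -/
def h₁₂ : ℝ := ∑ μ, F.κ μ * ((F.a μ : ℝ) - F.b μ) * ((F.c μ : ℝ) - F.d μ)

/-- `∑_μ κ_μ [(c_μ - d_μ)² - (c_μ + d_μ)]`. -/
def h₂₂ : ℝ := ∑ μ, F.κ μ * (((F.c μ : ℝ) - F.d μ) ^ 2 - ((F.c μ : ℝ) + F.d μ))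

/-- The matrix whose determinant is required not to vanish. -/
noncomputable def conditionMatrix (α₁ α₂ : ℝ) : Matrix (Fin 2) (Fin 2) ℂ :=
  !![4 * (α₁ : ℂ) + Complex.I * (Real.pi : ℂ) * (α₁ : ℂ) * ((F.h₁₁ / F.g₁ : ℝ) : ℂ),
      Complex.I * (Real.pi : ℂ) * (α₁ : ℂ) * ((F.h₁₂ / F.g₁ : ℝ) : ℂ);
    Complex.I * (Real.pi : ℂ) * (α₁ : ℂ) * ((F.h₁₂ / F.g₁ : ℝ) : ℂ),
      4 * (α₂ : ℂ) + Complex.I * (Real.pi : ℂ) * (α₂ : ℂ) * ((F.h₂₂ / F.g₂ : ℝ) : ℂ)]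

/-- `Γ = -2^{ℓ-2} α₁ / ∑_μ κ_μ (a_μ - b_μ)`. -/
noncomputable def Γ (α₁ : ℝ) : ℝ := -((2 : ℝ) ^ ((ℓ : ℤ) - 2) * α₁) / F.g₁

/-- The exponent `S(ξ₁, ξ₂) = ∑_i [α_i H(ξ_i) + i (π/2) α_i ξ_i] - log 2 + i π Γ f(ξ₁, ξ₂)`,
with `H` the binary entropy. -/
noncomputable def S (α₁ α₂ : ℝ) (ξ₁ ξ₂ : ℝ) : ℂ :=
  ((α₁ * Real.binEntropy ξ₁ + α₂ * Real.binEntropy ξ₂ - Real.log 2 : ℝ) : ℂ) +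
    Complex.I * ((Real.pi / 2 * (α₁ * ξ₁ + α₂ * ξ₂) + Real.pi * F.Γ α₁ * F.f ξ₁ ξ₂ : ℝ) : ℂ)

/-- The Hessian matrix of `S` at `(1/2, 1/2)`. -/
noncomputable def hessianS (α₁ α₂ : ℝ) : Matrix (Fin 2) (Fin 2) ℂ :=
  !![deriv (fun x => deriv (fun x' => F.S α₁ α₂ x' (1 / 2)) x) (1 / 2),
      deriv (fun x => deriv (fun y => F.S α₁ α₂ x y) (1 / 2)) (1 / 2);
    deriv (fun y => deriv (fun x => F.S α₁ α₂ x y) (1 / 2)) (1 / 2),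
      deriv (fun y => deriv (fun y' => F.S α₁ α₂ (1 / 2) y') y) (1 / 2)]

end LeadingForm

end QAOA

/-! At β = -π/4 every entry of the mixer `e^{iβB}` has modulus `2^{-n/2}`, and each bit where two
strings differ contributes a factor `-i`. The cost is symmetric, hence a function `c(k₁, k₂)` of the
block distances. So the amplitude at `s` is the expectation of `exp(i(γ c(k₁,k₂) - π(k₁+k₂)/2))` for
independent fair binomials `k₁, k₂`.

Put `k_i = n_i/2 + √n_i z_i/2`. The leading part of the phase is `-πΓ n f(k₁/n₁, k₂/n₂) -
π(k₁+k₂)/2`. The choice of Γ and the gradient condition cancel its linear terms at the balanced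
point (`Γ_mul_partialDeriv_one_zero`, `Γ_mul_partialDeriv_zero_one`). A constant and a fixed
quadratic form in `(z₁, z₂)` remain, with error of order `n^{-1/2}` on bounded windows
(`exists_phase_bound`).

The `O(n^{ℓ-1})` error in the cost becomes an `O(1)` phase, which size alone does not make
negligible. Locality handles it: differences of order `L+1` of `c` vanish, so `c` is a polynomial of
bounded degree in each distance. A polynomial of bounded degree that is bounded on `0, …, N` varies
there at rate `O(1/N)`, so over windows of width `√n` the residual is constant up to `O(n^{-1/2})`
(`exists_residual_lipschitz`). It is thus a global phase, invisible in the modulus.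

By the central limit theorem, with Chebyshev tails, the modulus converges to that of a Gaussian
average of `exp(iQ)`, with `Q` the quadratic form (`tendsto_norm_sum_coinWeight_cexp`). This average
is explicit, and its squared modulus is `16 α₁ α₂ / |det H_S|`. -/

/-! ### Entries of the mixer and the amplitude at β = -π/4 -/

open Complex in
theorem exp_smul_of_mul_self_eq_one {A : Type*} [NormedRing A] [NormedAlgebra ℂ A]
    [CompleteSpace A] (z : ℂ) {a : A} (ha : a * a = 1) :
    NormedSpace.exp (z • a) = cosh z • (1 : A) + sinh z • a := by
  have hev : ∀ n, a ^ (2 * n) = 1 := fun n => by rw [pow_mul, pow_two, ha, one_pow]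
  have hs := NormedSpace.exp_series_hasSum_exp' (𝕂 := ℂ) (z • a)
  -- Since `a² = 1`, the even terms of the series are multiples of `1` and the odd terms multiples
  -- of `a`.
  refine hs.unique (HasSum.even_add_odd ?_ ?_)
  · convert (hasSum_cosh z).smul_const (1 : A) using 2 with n
    rw [smul_pow, hev, smul_smul, div_eq_inv_mul]
  · convert (hasSum_sinh z).smul_const a using 2 with n
    rw [smul_pow, pow_succ a, hev, one_mul, smul_smul, div_eq_inv_mul]

namespace QAOA

theorem add_self_bitString {ι : Type} (v : BitString ι) : v + v = 0 := by
  ext i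
  exact CharTwo.add_self_eq_zero _

section Circuit

variable {ι : Type} [Fintype ι] [DecidableEq ι]

theorem pauliX_mul_apply (j : ι) (M : Matrix (BitString ι) (BitString ι) ℂ) (y x : BitString ι) :
    (pauliX j * M) y x = M (y + Pi.single j 1) x := by
  rw [Matrix.mul_apply, Finset.sum_eq_single (y + Pi.single j 1)]
  · rw [pauliX, if_pos (by rw [add_assoc, add_self_bitString, add_zero]), one_mul]
  · intro b _ hb
    rw [pauliX, if_neg, zero_mul]
    rintro rfl
    exact hb (by rw [add_assoc, add_self_bitString, add_zero])
  · simp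

theorem pauliX_mul_self (j : ι) : pauliX (ι := ι) j * pauliX j = 1 := by
  ext y x
  rw [pauliX_mul_apply, pauliX, Matrix.one_apply]
  simp [add_left_inj]

theorem pauliX_commute (i j : ι) : Commute (pauliX (ι := ι) i) (pauliX j) := by
  have key : ∀ (u v x y : BitString ι), y + u = x + v → y + v = x + u := fun u v x y h => by
    calc y + v = (y + u) + (u + v) := by
          rw [add_assoc, ← add_assoc u, add_self_bitString, zero_add]
      _ = x + u + (v + v) := by rw [h]; abel
      _ = x + u := by rw [add_self_bitString, add_zero]
  ext y x
  rw [pauliX_mul_apply, pauliX_mul_apply, pauliX, pauliX]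
  congr 1
  exact eq_iff_iff.mpr ⟨key _ _ _ _, key _ _ _ _⟩

theorem exp_smul_pauliX (β : ℝ) (j : ι) :
    NormedSpace.exp ((Complex.I * (β : ℂ)) • pauliX (ι := ι) j) =
      Complex.cos β • (1 : Matrix (BitString ι) (BitString ι) ℂ) +
        (Complex.I * Complex.sin β) • pauliX j := by
  let _ : NormedRing (Matrix (BitString ι) (BitString ι) ℂ) := Matrix.linftyOpNormedRing
  let _ : NormedAlgebra ℂ (Matrix (BitString ι) (BitString ι) ℂ) := Matrix.linftyOpNormedAlgebra
  have := exp_smul_of_mul_self_eq_one (Complex.I * (β : ℂ)) (pauliX_mul_self j)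
  rw [mul_comm Complex.I, Complex.cosh_mul_I, Complex.sinh_mul_I,
    mul_comm (Complex.sin _)] at this
  rw [mul_comm Complex.I (β : ℂ)]
  exact this

/-- The `X_j` commute, so the exponential factors over bits. A bit outside `T` carries an entry of
the identity, 1 or 0, which lets the product run over all bits throughout the induction. -/
theorem exp_smul_sum_pauliX_apply (β : ℝ) (T : Finset ι) (y x : BitString ι) :
    NormedSpace.exp ((Complex.I * (β : ℂ)) • ∑ j ∈ T, pauliX (ι := ι) j) y x =
      ∏ j, if y j = x j then (if j ∈ T then Complex.cos β else 1)
        else (if j ∈ T then Complex.I * Complex.sin β else 0) := by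
  induction T using Finset.induction_on generalizing y with
  | empty =>
    simp only [Finset.sum_empty, smul_zero, NormedSpace.exp_zero, Matrix.one_apply,
      Finset.notMem_empty, if_false]
    by_cases h : y = x
    · simp [h]
    · obtain ⟨j, hj⟩ := Function.ne_iff.mp h
      rw [if_neg h, Finset.prod_eq_zero (Finset.mem_univ j)]
      rw [if_neg hj]
  | insert j T hj ih =>
    have hcomm : Commute ((Complex.I * (β : ℂ)) • pauliX (ι := ι) j)
        ((Complex.I * (β : ℂ)) • ∑ i ∈ T, pauliX (ι := ι) i) :=
      ((Commute.sum_right _ _ _ fun i _ => pauliX_commute j i).smul_left _).smul_right _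
    rw [Finset.sum_insert hj, smul_add, Matrix.exp_add_of_commute _ _ hcomm, exp_smul_pauliX,
      add_mul, Matrix.add_apply, smul_mul_assoc, one_mul, smul_mul_assoc, Matrix.smul_apply,
      Matrix.smul_apply, pauliX_mul_apply, ih, ih, ← Finset.mul_prod_erase _ _ (Finset.mem_univ j),
      ← Finset.mul_prod_erase _ _ (Finset.mem_univ j),
      ← Finset.mul_prod_erase _ _ (Finset.mem_univ j)]
    have h1 : ∏ i ∈ Finset.univ.erase j, (if (y + Pi.single j 1 : BitString ι) i = x i
          then (if i ∈ T then Complex.cos β else 1)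
          else (if i ∈ T then Complex.I * Complex.sin β else 0)) =
        ∏ i ∈ Finset.univ.erase j, (if y i = x i
          then (if i ∈ T then Complex.cos β else 1)
          else (if i ∈ T then Complex.I * Complex.sin β else 0)) := by
      refine Finset.prod_congr rfl fun i hi => ?_
      rw [Pi.add_apply, Pi.single_eq_of_ne (Finset.ne_of_mem_erase hi), add_zero]
    have h2 : ∏ i ∈ Finset.univ.erase j, (if y i = x i
          then (if i ∈ insert j T then Complex.cos β else 1)
          else (if i ∈ insert j T then Complex.I * Complex.sin β else 0)) =
        ∏ i ∈ Finset.univ.erase j, (if y i = x i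
          then (if i ∈ T then Complex.cos β else 1)
          else (if i ∈ T then Complex.I * Complex.sin β else 0)) := by
      refine Finset.prod_congr rfl fun i hi => ?_
      simp [Finset.mem_insert, Finset.ne_of_mem_erase hi]
    rw [h1, h2, Pi.add_apply, Pi.single_eq_same]
    have h3 : ∀ a b : ZMod 2, (a + 1 = b) ↔ ¬ a = b := by decide
    simp only [h3, hj, if_false, Finset.mem_insert_self, if_true, smul_eq_mul]
    by_cases h : y j = x j <;> simp [h]

theorem exp_mixer_apply (β : ℝ) (y x : BitString ι) :
    NormedSpace.exp ((Complex.I * (β : ℂ)) • mixer ι) y x =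
      ∏ j, if y j = x j then Complex.cos β else Complex.I * Complex.sin β := by
  simpa [mixer] using exp_smul_sum_pauliX_apply β Finset.univ y x

theorem exp_costOperator (C : BitString ι → ℝ) (γ : ℝ) :
    NormedSpace.exp ((Complex.I * (γ : ℂ)) • costOperator C) =
      Matrix.diagonal fun x => Complex.exp (Complex.I * γ * C x) := by
  rw [costOperator, ← Matrix.diagonal_smul, Matrix.exp_diagonal]
  congr 1
  ext x
  rw [Pi.coe_exp]
  simp [Complex.exp_eq_exp_ℂ]

theorem exp_mixer_quarter_apply (y x : BitString ι) :
    NormedSpace.exp ((Complex.I * ((-(Real.pi / 4) : ℝ) : ℂ)) • mixer ι) y x =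
      (((Real.sqrt 2 / 2) ^ Fintype.card ι : ℝ) : ℂ) * (-Complex.I) ^ hammingDist x y := by
  rw [exp_mixer_apply, ← Complex.ofReal_cos, ← Complex.ofReal_sin, Real.cos_neg, Real.sin_neg,
    Real.cos_pi_div_four, Real.sin_pi_div_four]
  have : ∀ j, (if y j = x j then ((Real.sqrt 2 / 2 : ℝ) : ℂ)
      else Complex.I * ((-(Real.sqrt 2 / 2) : ℝ) : ℂ)) =
      ((Real.sqrt 2 / 2 : ℝ) : ℂ) * if x j ≠ y j then -Complex.I else 1 := by
    intro j
    by_cases h : y j = x j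
    · simp [h]
    · rw [if_neg h, if_pos (Ne.symm h)]; push_cast; ring
  rw [Finset.prod_congr rfl fun j _ => this j, Finset.prod_mul_distrib, Finset.prod_ite]
  simp [hammingDist, div_pow]

theorem state_quarter_apply (C : BitString ι → ℝ) (γ : ℝ) (y : BitString ι) :
    state C (-(Real.pi / 4)) γ y =
      ((1 / 2 : ℂ) ^ Fintype.card ι) *
        ∑ x, (-Complex.I) ^ hammingDist x y * Complex.exp (Complex.I * γ * C x) := by
  have hc : (((Real.sqrt 2 / 2) ^ Fintype.card ι : ℝ) : ℂ) *
      ((1 / Real.sqrt (2 ^ Fintype.card ι) : ℝ) : ℂ) = (1 / 2 : ℂ) ^ Fintype.card ι := by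
    rw [← Complex.ofReal_mul]
    have : (Real.sqrt 2 / 2) ^ Fintype.card ι * (1 / Real.sqrt (2 ^ Fintype.card ι)) =
        (1 / 2) ^ Fintype.card ι := by
      have h2 : Real.sqrt (2 ^ Fintype.card ι) = Real.sqrt 2 ^ Fintype.card ι := by
        rw [Real.sqrt_eq_iff_mul_self_eq (by positivity) (by positivity), ← mul_pow,
          Real.mul_self_sqrt zero_le_two]
      rw [h2, div_pow, div_pow, one_pow]
      field_simp
    rw [this]; push_cast; rfl
  rw [state, exp_costOperator, Matrix.mulVec, dotProduct, Finset.mul_sum]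
  refine Finset.sum_congr rfl fun x _ => ?_
  rw [Matrix.mulVec_diagonal, exp_mixer_quarter_apply, ← hc, uniformState]
  ring

end Circuit

end QAOA

/-! ### Symmetry and locality: the cost as a function of the two block distances -/

namespace QAOA

theorem hammingDist_eq_dist₁_add_dist₂ {n₁ n₂ : ℕ} (x s : BitString (Fin n₁ ⊕ Fin n₂)) :
    hammingDist x s = dist₁ x s + dist₂ x s := by
  simp only [hammingDist, dist₁, dist₂, Finset.card_filter, Fintype.sum_sum_type]

/-- A string corresponds to the set of positions where it differs from `t`, and the distance is the
size of that set. -/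
theorem sum_hammingDist {n : ℕ} {M : Type*} [AddCommMonoid M] (t : Fin n → ZMod 2) (g : ℕ → M) :
    ∑ y : Fin n → ZMod 2, g (hammingDist y t) =
      ∑ k ∈ Finset.range (n + 1), n.choose k • g k := by
  have h := Finset.sum_powerset_apply_card g (x := (Finset.univ : Finset (Fin n)))
  rw [Finset.card_univ, Fintype.card_fin] at h
  rw [← h, Finset.powerset_univ]
  have hz : ∀ a b : ZMod 2, (if a ≠ b then b + 1 else b) = a := by decide
  refine Finset.sum_bij' (fun y _ => Finset.univ.filter fun i => y i ≠ t i)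
    (fun A _ i => if i ∈ A then t i + 1 else t i) (by simp) (by simp) ?_ ?_ ?_
  · intro y _
    ext i
    simpa using hz (y i) (t i)
  · intro A _
    ext i
    by_cases hi : i ∈ A <;> simp [hi]
  · intro y _
    rfl

theorem sum_dist₁_dist₂ {n₁ n₂ : ℕ} {M : Type*} [AddCommMonoid M]
    (s : BitString (Fin n₁ ⊕ Fin n₂)) (g : ℕ → ℕ → M) :
    ∑ x, g (dist₁ x s) (dist₂ x s) = ∑ k₁ ∈ Finset.range (n₁ + 1), n₁.choose k₁ •
      ∑ k₂ ∈ Finset.range (n₂ + 1), n₂.choose k₂ • g k₁ k₂ := by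
  rw [← sum_hammingDist (fun i => s (Sum.inl i)),
    ← (Equiv.sumArrowEquivProdArrow (Fin n₁) (Fin n₂) (ZMod 2)).symm.sum_comp,
    Fintype.sum_prod_type]
  refine Finset.sum_congr rfl fun y _ => ?_
  rw [← sum_hammingDist (fun i => s (Sum.inr i))]
  rfl

/-- The bit string `s` with the bits in `W` flipped. -/
def flipBits {ι : Type} [DecidableEq ι] (s : BitString ι) (W : Finset ι) : BitString ι :=
  fun i => if i ∈ W then s i + 1 else s i

theorem dist₁_flipBits {n₁ n₂ : ℕ} (s : BitString (Fin n₁ ⊕ Fin n₂))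
    (W : Finset (Fin n₁ ⊕ Fin n₂)) : dist₁ (flipBits s W) s = W.toLeft.card := by
  rw [dist₁, hammingDist]
  congr 1
  ext i
  by_cases hi : Sum.inl i ∈ W <;> simp [hi, flipBits]

theorem dist₂_flipBits {n₁ n₂ : ℕ} (s : BitString (Fin n₁ ⊕ Fin n₂))
    (W : Finset (Fin n₁ ⊕ Fin n₂)) : dist₂ (flipBits s W) s = W.toRight.card := by
  rw [dist₂, hammingDist]
  congr 1
  ext i
  by_cases hi : Sum.inr i ∈ W <;> simp [hi, flipBits]

/-- Over `ZMod 2` a string is determined by its support; a bijection between supports of equal size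
extends to a permutation. -/
theorem exists_perm_comp_eq {n : ℕ} {y y' : Fin n → ZMod 2}
    (h : hammingNorm y = hammingNorm y') : ∃ π : Equiv.Perm (Fin n), ∀ i, y (π i) = y' i := by
  classical
  have hcard : Fintype.card {i // y' i ≠ 0} = Fintype.card {i // y i ≠ 0} := by
    rw [Fintype.card_subtype, Fintype.card_subtype]
    exact h.symm
  have e := Fintype.equivOfCardEq hcard
  have hz : ∀ a b : ZMod 2, (a ≠ 0 ↔ b ≠ 0) → a = b := by decide
  refine ⟨e.extendSubtype, fun i => hz _ _ ?_⟩
  by_cases hi : y' i ≠ 0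
  · exact iff_of_true (e.extendSubtype_mem i hi) hi
  · exact iff_of_false (e.extendSubtype_not_mem i hi) hi

theorem IsSymmetricRel.eq_of_dist_eq {n₁ n₂ : ℕ} {s : BitString (Fin n₁ ⊕ Fin n₂)}
    {C : BitString (Fin n₁ ⊕ Fin n₂) → ℝ} (hC : IsSymmetricRel (productSymmetry n₁ n₂) s C)
    {x x' : BitString (Fin n₁ ⊕ Fin n₂)} (h₁ : dist₁ x s = dist₁ x' s)
    (h₂ : dist₂ x s = dist₂ x' s) : C x = C x' := by
  have hd : ∀ {n : ℕ} (a b : Fin n → ZMod 2), hammingDist a b = hammingNorm (a + b) := by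
    intro n a b
    rw [hammingDist_eq_hammingNorm]
    congr 1
    ext i
    have hz : ∀ a b : ZMod 2, -a + b = a + b := by decide
    exact hz _ _
  rw [dist₁, dist₁, hd, hd] at h₁
  rw [dist₂, dist₂, hd, hd] at h₂
  obtain ⟨π₁, hπ₁⟩ := exists_perm_comp_eq h₁
  obtain ⟨π₂, hπ₂⟩ := exists_perm_comp_eq h₂
  have := hC (Equiv.Perm.sumCongr π₁ π₂) ⟨(π₁, π₂), rfl⟩ x
  rw [← this]
  congr 1
  ext i
  have hz : ∀ a b : ZMod 2, a + b + b = a := by decide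
  rcases i with i | i
  · have := hπ₁ i
    simp only [Pi.add_apply] at this
    simp [this, hz]
  · have := hπ₂ i
    simp only [Pi.add_apply] at this
    simp [this, hz]

/-- As `R` has more than `L` elements, each clause ignores some `r ∈ R`. Pairing `A` with `insert r
A` leaves that clause unchanged and reverses the sign, so its contribution cancels. -/
theorem IsLocal.alternating_sum_flipBits {ι : Type} [DecidableEq ι] {L : ℕ}
    {C : BitString ι → ℝ} (hC : IsLocal L C) (s : BitString ι) (W R : Finset ι)
    (hR : L < R.card) :
    ∑ A ∈ R.powerset, (-1 : ℝ) ^ A.card * C (flipBits s (W ∪ A)) = 0 := by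
  obtain ⟨N, clause, hclause, hsum⟩ := hC
  simp only [hsum, Finset.mul_sum]
  rw [Finset.sum_comm]
  refine Finset.sum_eq_zero fun j _ => ?_
  obtain ⟨T, hT, hdep⟩ := hclause j
  obtain ⟨r, hrR, hrT⟩ : ∃ r ∈ R, r ∉ T := by
    by_contra! hsub
    exact absurd (Finset.card_le_card hsub) (by omega)
  rw [← Finset.insert_erase hrR, Finset.sum_powerset_insert (Finset.notMem_erase r R),
    ← Finset.sum_add_distrib]
  refine Finset.sum_eq_zero fun A hA => ?_
  have hrA : r ∉ A := fun h => Finset.notMem_erase r R (Finset.mem_powerset.mp hA h)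
  have : clause j (flipBits s (W ∪ insert r A)) = clause j (flipBits s (W ∪ A)) := by
    refine hdep fun i hi => ?_
    have : i ≠ r := fun h => hrT (h ▸ hi)
    simp [flipBits, this]
  rw [this, Finset.card_insert_of_notMem hrA, pow_succ]
  ring

theorem exists_finset_disjoint_card {n k m : ℕ} (h : k + m ≤ n) :
    ∃ U R : Finset (Fin n), U.card = k ∧ R.card = m ∧ Disjoint U R := by
  obtain ⟨V, -, hV⟩ := Finset.exists_subset_card_eq
    (s := (Finset.univ : Finset (Fin n))) (n := k + m) (by simpa using h)
  obtain ⟨U, hUV, hU⟩ := Finset.exists_subset_card_eq (s := V) (n := k) (by omega)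
  exact ⟨U, V \ U, hU, by rw [Finset.card_sdiff_of_subset hUV]; omega, Finset.disjoint_sdiff⟩

theorem exists_dist_eq {n₁ n₂ : ℕ} (s : BitString (Fin n₁ ⊕ Fin n₂)) {k₁ k₂ : ℕ}
    (h₁ : k₁ ≤ n₁) (h₂ : k₂ ≤ n₂) : ∃ x, dist₁ x s = k₁ ∧ dist₂ x s = k₂ := by
  obtain ⟨U, -, hU, -, -⟩ := exists_finset_disjoint_card (m := 0) h₁
  obtain ⟨V, -, hV, -, -⟩ := exists_finset_disjoint_card (m := 0) h₂
  exact ⟨flipBits s (U.disjSum V), by simp [dist₁_flipBits, hU], by simp [dist₂_flipBits, hV]⟩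

/-- A symmetric local cost is a function of the two block distances whose finite differences of
order `L + 1` in either distance vanish. -/
theorem exists_levelCost {n₁ n₂ L : ℕ} {s : BitString (Fin n₁ ⊕ Fin n₂)}
    {C : BitString (Fin n₁ ⊕ Fin n₂) → ℝ} (hC : IsSymmetricRel (productSymmetry n₁ n₂) s C)
    (hL : IsLocal L C) :
    ∃ c : ℕ → ℕ → ℝ, (∀ x, C x = c (dist₁ x s) (dist₂ x s)) ∧
      (∀ k₁ k₂, k₁ + (L + 1) ≤ n₁ → k₂ ≤ n₂ →
        ∑ j ∈ Finset.range (L + 2), ((L + 1).choose j : ℝ) * ((-1) ^ j * c (k₁ + j) k₂) = 0) ∧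
      (∀ k₁ k₂, k₁ ≤ n₁ → k₂ + (L + 1) ≤ n₂ →
        ∑ j ∈ Finset.range (L + 2), ((L + 1).choose j : ℝ) * ((-1) ^ j * c k₁ (k₂ + j)) = 0) := by
  classical
  -- The value 0 is taken only at pairs of distances that no string attains; the range conditions
  -- below exclude them.
  let c : ℕ → ℕ → ℝ := fun k₁ k₂ =>
    if h : ∃ x, dist₁ x s = k₁ ∧ dist₂ x s = k₂ then C h.choose else 0
  have hc : ∀ x, C x = c (dist₁ x s) (dist₂ x s) := fun x => by
    have h : ∃ x', dist₁ x' s = dist₁ x s ∧ dist₂ x' s = dist₂ x s := ⟨x, rfl, rfl⟩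
    simp only [c, dif_pos h]
    exact hC.eq_of_dist_eq h.choose_spec.1.symm h.choose_spec.2.symm
  refine ⟨c, hc, fun k₁ k₂ h₁ h₂ => ?_, fun k₁ k₂ h₁ h₂ => ?_⟩
  · obtain ⟨U, R, hU, hR, hUR⟩ := exists_finset_disjoint_card h₁
    obtain ⟨V, -, hV, -, -⟩ := exists_finset_disjoint_card (m := 0) h₂
    -- Flipping `A ⊆ R` on top of `U` and `V` raises the first distance from `k₁` to `k₁ + |A|`.
    -- Grouping the subsets by size turns the alternating sum into a finite difference.
    have key := hL.alternating_sum_flipBits s (U.disjSum V) (R.map Function.Embedding.inl)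
      (by rw [Finset.card_map, hR]; omega)
    have hsum := Finset.sum_powerset_apply_card (fun j => (-1 : ℝ) ^ j * c (k₁ + j) k₂)
      (x := R.map (Function.Embedding.inl (β := Fin n₂)))
    simp only [Finset.card_map, hR, nsmul_eq_mul] at hsum
    rw [← hsum, ← key]
    refine Finset.sum_congr rfl fun A hA => ?_
    rw [Finset.mem_powerset] at hA
    have hr : A.toRight = ∅ := by
      refine Finset.eq_empty_of_forall_notMem fun i hi => ?_
      simpa using hA (Finset.mem_toRight.mp hi)
    have hl : A.toLeft.card = A.card := by
      simpa [hr] using A.card_toLeft_add_card_toRight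
    have hd : Disjoint U A.toLeft := by
      refine hUR.mono_right fun i hi => ?_
      simpa using hA (Finset.mem_toLeft.mp hi)
    rw [hc, dist₁_flipBits, dist₂_flipBits, Finset.toLeft_union, Finset.toRight_union, hr,
      Finset.toLeft_disjSum, Finset.toRight_disjSum, Finset.card_union_of_disjoint hd, hU, hl,
      Finset.union_empty, hV]
  · obtain ⟨V, R, hV, hR, hVR⟩ := exists_finset_disjoint_card h₂
    obtain ⟨U, -, hU, -, -⟩ := exists_finset_disjoint_card (m := 0) h₁
    have key := hL.alternating_sum_flipBits s (U.disjSum V) (R.map Function.Embedding.inr)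
      (by rw [Finset.card_map, hR]; omega)
    have hsum := Finset.sum_powerset_apply_card (fun j => (-1 : ℝ) ^ j * c k₁ (k₂ + j))
      (x := R.map (Function.Embedding.inr (α := Fin n₁)))
    simp only [Finset.card_map, hR, nsmul_eq_mul] at hsum
    rw [← hsum, ← key]
    refine Finset.sum_congr rfl fun A hA => ?_
    rw [Finset.mem_powerset] at hA
    have hl : A.toLeft = ∅ := by
      refine Finset.eq_empty_of_forall_notMem fun i hi => ?_
      simpa using hA (Finset.mem_toLeft.mp hi)
    have hr : A.toRight.card = A.card := by
      simpa [hl] using A.card_toLeft_add_card_toRight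
    have hd : Disjoint V A.toRight := by
      refine hVR.mono_right fun i hi => ?_
      simpa using hA (Finset.mem_toRight.mp hi)
    rw [hc, dist₁_flipBits, dist₂_flipBits, Finset.toLeft_union, Finset.toRight_union, hl,
      Finset.toLeft_disjSum, Finset.toRight_disjSum, Finset.card_union_of_disjoint hd, hV, hr,
      Finset.union_empty, hU]

end QAOA

/-! ### Polynomials on an integer range: finite differences and Lipschitz bounds -/

-- The interpolant through `0, …, L` satisfies the same recurrence. The last coefficient of the
-- recurrence is `±1`, so each value is determined by the preceding `L + 1`, and the two sequences
-- agree up to `N`.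
open Polynomial in
theorem exists_polynomial_of_alternating_sum_eq_zero {N L : ℕ} {c : ℕ → ℝ}
    (h : ∀ k, k + (L + 1) ≤ N →
      ∑ j ∈ Finset.range (L + 2), ((L + 1).choose j : ℝ) * ((-1) ^ j * c (k + j)) = 0) :
    ∃ p : ℝ[X], p.natDegree ≤ L ∧ ∀ k ≤ N, c k = p.eval (k : ℝ) := by
  have hinj : Set.InjOn (fun i : ℕ => (i : ℝ)) (Finset.range (L + 1)) :=
    Nat.cast_injective.injOn
  set p := Lagrange.interpolate (Finset.range (L + 1)) (fun i : ℕ => (i : ℝ)) c with hp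
  have hdeg : p.natDegree ≤ L := by
    have := Lagrange.degree_interpolate_lt c hinj
    rw [Finset.card_range] at this
    rcases eq_or_ne p 0 with h0 | h0
    · simp [h0]
    · exact Nat.lt_succ_iff.mp ((natDegree_lt_iff_degree_lt h0).mpr this)
  have hdiff : ∀ k : ℕ, ∑ j ∈ Finset.range (L + 2),
      ((L + 1).choose j : ℝ) * ((-1) ^ j * p.eval ((k + j : ℕ) : ℝ)) = 0 := by
    intro k
    have h0 := congrFun (fwdDiff_iter_eq_zero_of_degree_lt (Nat.lt_succ_of_le hdeg)) (k : ℝ)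
    rw [fwdDiff_iter_eq_sum_shift, Pi.zero_apply] at h0
    have h1 : ∑ j ∈ Finset.range (L + 2),
        ((L + 1).choose j : ℝ) * ((-1) ^ j * p.eval ((k + j : ℕ) : ℝ)) =
        (-1) ^ (L + 1) * ∑ j ∈ Finset.range (L + 1 + 1),
          ((-1 : ℤ) ^ (L + 1 - j) * ((L + 1).choose j : ℤ)) • p.eval ((k : ℝ) + j • 1) := by
      rw [Finset.mul_sum]
      refine Finset.sum_congr rfl fun j hj => ?_
      have hj' : j ≤ L + 1 := Nat.lt_succ_iff.mp (Finset.mem_range.mp hj)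
      have hs : (-1 : ℝ) ^ (L + 1) * (-1) ^ (L + 1 - j) = (-1) ^ j := by
        rw [← pow_add, show L + 1 + (L + 1 - j) = j + 2 * (L + 1 - j) by omega, pow_add, pow_mul]
        norm_num
      rw [zsmul_eq_mul, nsmul_eq_mul]
      push_cast
      rw [← hs, mul_one]
      ring
    rw [h1]
    exact mul_eq_zero_of_right _ h0
  refine ⟨p, hdeg, fun k => ?_⟩
  induction k using Nat.strong_induction_on with
  | _ k ih =>
    intro hk
    rcases lt_or_ge k (L + 1) with hkL | hkL
    · exact (Lagrange.eval_interpolate_at_node c hinj (Finset.mem_range.mpr hkL)).symm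
    · obtain ⟨i, rfl⟩ := Nat.exists_eq_add_of_le' hkL
      have h0 := h i hk
      have h1 := hdiff i
      rw [Finset.sum_range_succ] at h0 h1
      have h2 : ∑ j ∈ Finset.range (L + 1), ((L + 1).choose j : ℝ) * ((-1) ^ j * c (i + j)) =
          ∑ j ∈ Finset.range (L + 1),
            ((L + 1).choose j : ℝ) * ((-1) ^ j * p.eval ((i + j : ℕ) : ℝ)) :=
        Finset.sum_congr rfl fun j hj => by
          rw [ih (i + j) (by have := Finset.mem_range.mp hj; omega)
            (by have := Finset.mem_range.mp hj; omega)]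
      rw [h2] at h0
      have h3 := add_left_cancel (h0.trans h1.symm)
      rw [Nat.choose_self, Nat.cast_one, one_mul, one_mul] at h3
      exact mul_left_cancel₀ (pow_ne_zero _ (by norm_num)) h3

open Polynomial in
theorem Polynomial.exists_lipschitz_bound (p : ℝ[X]) (R : ℝ) :
    ∃ A : ℝ, 0 ≤ A ∧ ∀ t ∈ Set.Icc 0 R, ∀ t' ∈ Set.Icc 0 R,
      |p.eval t - p.eval t'| ≤ A * |t - t'| := by
  obtain ⟨A, hA⟩ := (isCompact_Icc (a := (0 : ℝ)) (b := R)).exists_bound_of_continuousOn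
    p.derivative.continuousOn
  refine ⟨max A 0, le_max_right _ _, fun t ht t' ht' => ?_⟩
  exact (convex_Icc 0 R).norm_image_sub_le_of_norm_deriv_le (f := fun x => p.eval x)
    (fun x _ => p.differentiableAt) (fun x hx => by
      rw [Polynomial.deriv]; exact (hA x hx).trans (le_max_left _ _)) ht' ht

open Polynomial in
/-- A polynomial of degree at most `D` that is bounded by `K` at `0, …, N` is Lipschitz there, with
a constant of order `K / N`. -/
theorem exists_lipschitz_bound_of_bounded_on_range (D : ℕ) (hD : 1 ≤ D) :
    ∃ A : ℝ, 0 ≤ A ∧ ∀ (N : ℕ) (p : ℝ[X]) (K : ℝ), D ≤ N → p.natDegree ≤ D →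
      (∀ k ≤ N, |p.eval (k : ℝ)| ≤ K) → ∀ k ≤ N, ∀ k' ≤ N,
        |p.eval (k : ℝ) - p.eval (k' : ℝ)| ≤ A * K * (|(k : ℝ) - k'| / N) := by
  have hinj : Set.InjOn (fun i : ℕ => (i : ℝ)) (Finset.range (D + 1)) :=
    Nat.cast_injective.injOn
  choose A hA0 hA using fun i : ℕ =>
    (Lagrange.basis (Finset.range (D + 1)) (fun i : ℕ => (i : ℝ)) i).exists_lipschitz_bound (2 * D)
  refine ⟨(∑ i ∈ Finset.range (D + 1), A i) * (2 * D),
    mul_nonneg (Finset.sum_nonneg fun i _ => hA0 i) (by positivity),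
    fun N p K hDN hp hK k hk k' hk' => ?_⟩
  -- Sampling at `0, h, …, Dh ≤ N` makes the rescaled polynomial `q` a combination of fixed Lagrange
  -- basis polynomials with coefficients at most `K`. The bound `N ≤ 2Dh` keeps `k/h` in `[0, 2D]`
  -- and converts `1/h` into `2D/N`.
  set h : ℕ := N / D with hh
  have hh1 : 1 ≤ h := (Nat.one_le_div_iff (by omega)).mpr hDN
  have hhD : D * h ≤ N := Nat.mul_div_le N D
  have hN2 : N ≤ 2 * D * h := by
    have h1 : N < D * (h + 1) := Nat.lt_mul_div_succ N (by omega)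
    have h2 : D * 1 ≤ D * h := Nat.mul_le_mul_left D hh1
    nlinarith
  have hh0 : (0 : ℝ) < h := by exact_mod_cast hh1
  have hN0 : (0 : ℝ) < N := by exact_mod_cast (by omega : 0 < N)
  have hN2' : (N : ℝ) ≤ 2 * D * h := by exact_mod_cast hN2
  set q : ℝ[X] := p.comp (C (h : ℝ) * X) with hq
  have hqe : ∀ t : ℝ, q.eval t = p.eval (h * t) := fun t => by simp [hq]
  have hqd : q.degree < (Finset.range (D + 1)).card := by
    rw [Finset.card_range]
    refine degree_le_natDegree.trans_lt ?_
    have h1 : q.natDegree ≤ D := by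
      refine natDegree_comp_le.trans ?_
      calc p.natDegree * (C (h : ℝ) * X).natDegree ≤ D * 1 :=
            Nat.mul_le_mul hp (by compute_degree)
        _ = D := mul_one D
    exact_mod_cast Nat.lt_succ_of_le h1
  have hqi := Lagrange.eq_interpolate hinj hqd
  have hmem : ∀ k : ℕ, k ≤ N → ((k : ℝ) / h) ∈ Set.Icc (0 : ℝ) (2 * D) := fun k hk => by
    refine ⟨by positivity, (div_le_iff₀ hh0).mpr (le_trans ?_ hN2')⟩
    exact_mod_cast hk
  have hpq : ∀ k : ℕ, p.eval (k : ℝ) = q.eval ((k : ℝ) / h) := fun k => by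
    rw [hqe, mul_div_cancel₀ _ hh0.ne']
  have hK0 : 0 ≤ K := (abs_nonneg _).trans (hK 0 (Nat.zero_le N))
  rw [hpq, hpq, hqi, Lagrange.interpolate_apply, eval_finsetSum, eval_finsetSum,
    ← Finset.sum_sub_distrib]
  refine (Finset.abs_sum_le_sum_abs _ _).trans ?_
  have hterm : ∀ i ∈ Finset.range (D + 1),
      |eval ((k : ℝ) / h) (C (eval (i : ℝ) q) *
          Lagrange.basis (Finset.range (D + 1)) (fun i : ℕ => (i : ℝ)) i) -
        eval ((k' : ℝ) / h) (C (eval (i : ℝ) q) *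
          Lagrange.basis (Finset.range (D + 1)) (fun i : ℕ => (i : ℝ)) i)| ≤
      K * (A i * (|(k : ℝ) - k'| / h)) := by
    intro i hi
    have hi' : i ≤ D := Nat.lt_succ_iff.mp (Finset.mem_range.mp hi)
    rw [eval_C_mul, eval_C_mul, ← mul_sub, abs_mul]
    have h1 : |eval (i : ℝ) q| ≤ K := by
      rw [hqe]
      have := hK (h * i) (by rw [mul_comm]; exact (Nat.mul_le_mul_right h hi').trans hhD)
      exact_mod_cast this
    have h2 := hA i _ (hmem k hk) _ (hmem k' hk')
    rw [← sub_div, abs_div, abs_of_pos hh0] at h2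
    exact mul_le_mul h1 h2 (abs_nonneg _) hK0
  refine (Finset.sum_le_sum hterm).trans ?_
  rw [← Finset.mul_sum, ← Finset.sum_mul]
  have h3 : |(k : ℝ) - k'| / h ≤ 2 * D * (|(k : ℝ) - k'| / N) := by
    rw [mul_div_assoc', div_le_div_iff₀ hh0 hN0]
    nlinarith [abs_nonneg ((k : ℝ) - k')]
  calc K * ((∑ i ∈ Finset.range (D + 1), A i) * (|(k : ℝ) - k'| / h))
      ≤ K * ((∑ i ∈ Finset.range (D + 1), A i) * (2 * D * (|(k : ℝ) - k'| / N))) :=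
        mul_le_mul_of_nonneg_left (mul_le_mul_of_nonneg_left h3
          (Finset.sum_nonneg fun i _ => hA0 i)) hK0
    _ = _ := by ring

/-! ### The leading form as a polynomial in each variable -/

namespace QAOA.LeadingForm

open Polynomial

variable {ℓ : ℕ} (F : LeadingForm ℓ)

theorem exists_polynomial_fst (y : ℝ) :
    ∃ p : ℝ[X], p.natDegree ≤ ℓ ∧ ∀ x, F.f x y = p.eval x := by
  refine ⟨∑ μ, C (F.κ μ * (y ^ F.c μ * (1 - y) ^ F.d μ)) * (X ^ F.a μ * (1 - X) ^ F.b μ),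
    natDegree_sum_le_of_forall_le _ _ fun μ _ => ?_, fun x => ?_⟩
  · refine (natDegree_C_mul_le _ _).trans ?_
    have h1 : (1 - X : ℝ[X]).natDegree ≤ 1 := by compute_degree
    have h2 := natDegree_pow_le_of_le (F.b μ) h1
    have h3 : (X ^ F.a μ : ℝ[X]).natDegree ≤ F.a μ := natDegree_X_pow_le _
    have h4 := natDegree_mul_le_of_le h3 h2
    have := F.total μ
    omega
  · simp only [f, eval_finsetSum, eval_mul, eval_C, eval_pow, eval_X, eval_sub, eval_one]
    exact Finset.sum_congr rfl fun μ _ => by ring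

theorem exists_polynomial_snd (x : ℝ) :
    ∃ p : ℝ[X], p.natDegree ≤ ℓ ∧ ∀ y, F.f x y = p.eval y := by
  refine ⟨∑ μ, C (F.κ μ * (x ^ F.a μ * (1 - x) ^ F.b μ)) * (X ^ F.c μ * (1 - X) ^ F.d μ),
    natDegree_sum_le_of_forall_le _ _ fun μ _ => ?_, fun y => ?_⟩
  · refine (natDegree_C_mul_le _ _).trans ?_
    have h1 : (1 - X : ℝ[X]).natDegree ≤ 1 := by compute_degree
    have h2 := natDegree_pow_le_of_le (F.d μ) h1
    have h3 : (X ^ F.c μ : ℝ[X]).natDegree ≤ F.c μ := natDegree_X_pow_le _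
    have h4 := natDegree_mul_le_of_le h3 h2
    have := F.total μ
    omega
  · simp only [f, eval_finsetSum, eval_mul, eval_C, eval_pow, eval_X, eval_sub, eval_one]
    exact Finset.sum_congr rfl fun μ _ => by ring

end QAOA.LeadingForm

/-! ### Gaussian averages of quadratic phases -/

open MeasureTheory ProbabilityTheory Filter Topology Complex in
theorem integral_gaussianReal_cexp_quadratic {w : ℂ} (hw : w.re ≤ 0) (v : ℂ) :
    ∫ x : ℝ, cexp (w * x ^ 2 + v * x) ∂(gaussianReal 0 1) =
      (Real.sqrt (2 * Real.pi) : ℂ)⁻¹ * (Real.pi / (1 / 2 - w)) ^ (2⁻¹ : ℂ) *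
        cexp (v ^ 2 / (4 * (1 / 2 - w))) := by
  have h : ∀ x : ℝ, gaussianPDFReal 0 1 x • cexp (w * x ^ 2 + v * x) =
      (Real.sqrt (2 * Real.pi) : ℂ)⁻¹ * cexp ((w - 1 / 2) * x ^ 2 + v * x + 0) := fun x => by
    rw [gaussianPDFReal, Complex.real_smul]
    push_cast
    rw [mul_assoc, ← Complex.exp_add, mul_one]
    congr 2
    simp
    ring
  rw [integral_gaussianReal_eq_integral_smul one_ne_zero, integral_congr_ae (ae_of_all _ h),
    integral_const_mul, integral_cexp_quadratic (by simp; linarith), mul_assoc]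
  have h0 : w - 1 / 2 ≠ 0 := fun h0 => by
    have := congrArg Complex.re h0
    simp at this
    linarith
  have h0' : 1 / 2 - w ≠ 0 := fun h => h0 (by linear_combination -h)
  congr 3
  · rw [neg_sub]
  · norm_num
  · rw [show 4 * (w - 1 / 2) = -(4 * (1 / 2 - w)) by ring, div_neg, sub_neg_eq_add, zero_add]

-- The right-hand denominator is `|det(1 - iA)|` with `A` the matrix of the form. Integrating out
-- `y` leaves a quadratic exponent in `x` whose coefficient still has nonpositive real part, so the
-- one-variable formula applies twice. Squaring the modulus removes the choice of branch of the
-- square roots.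
open MeasureTheory ProbabilityTheory Complex in
theorem norm_integral_gaussianReal_cexp_quadratic_form (a b c : ℝ) :
    ‖∫ x, ∫ y, cexp (I * ((a * x ^ 2 / 2 + b * x * y + c * y ^ 2 / 2 : ℝ) : ℂ))
        ∂(gaussianReal 0 1) ∂(gaussianReal 0 1)‖ ^ 2 =
      1 / ‖(1 - I * a) * (1 - I * c) + (b : ℂ) ^ 2‖ := by
  have hc : (I * c / 2).re ≤ 0 := by simp
  have hc0 : (1 : ℂ) / 2 - I * c / 2 ≠ 0 := fun h => by
    have := congrArg Complex.re h
    norm_num at this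
  have hinner : ∀ x : ℝ, ∫ y, cexp (I * ((a * x ^ 2 / 2 + b * x * y + c * y ^ 2 / 2 : ℝ) : ℂ))
        ∂(gaussianReal 0 1) =
      ((Real.sqrt (2 * Real.pi) : ℂ)⁻¹ * (Real.pi / (1 / 2 - I * c / 2)) ^ (2⁻¹ : ℂ)) *
        cexp ((I * a / 2 + (I * b) ^ 2 / (4 * (1 / 2 - I * c / 2))) * x ^ 2 + 0 * x) := fun x => by
    have h : ∀ y : ℝ, cexp (I * ((a * x ^ 2 / 2 + b * x * y + c * y ^ 2 / 2 : ℝ) : ℂ)) =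
        cexp (I * a / 2 * x ^ 2) * cexp (I * c / 2 * y ^ 2 + (I * b * x) * y) := fun y => by
      rw [← Complex.exp_add]
      push_cast
      ring_nf
    rw [integral_congr_ae (ae_of_all _ h), integral_const_mul,
      integral_gaussianReal_cexp_quadratic hc, mul_left_comm, ← Complex.exp_add]
    congr 2
    field_simp
    ring
  have hw : (I * a / 2 + (I * b) ^ 2 / (4 * (1 / 2 - I * c / 2))).re ≤ 0 := by
    have h1 : (I * a / 2 + (I * b) ^ 2 / (4 * (1 / 2 - I * c / 2)) : ℂ) =
        I * a / 2 + ((-(b ^ 2 / 4) : ℝ) : ℂ) * (1 / 2 - I * c / 2)⁻¹ := by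
      rw [mul_pow, I_sq]
      push_cast
      field_simp
    have h2 : (1 / 2 - I * c / 2 : ℂ).re = 1 / 2 := by simp
    rw [h1, add_re, re_ofReal_mul, inv_re, h2]
    have h3 : (0 : ℝ) ≤ 1 / 2 / normSq (1 / 2 - I * c / 2) :=
      div_nonneg (by norm_num) (normSq_nonneg _)
    have h4 : (I * a / 2 : ℂ).re = 0 := by simp
    rw [h4]
    nlinarith [sq_nonneg b]
  rw [integral_congr_ae (ae_of_all _ hinner), integral_const_mul,
    integral_gaussianReal_cexp_quadratic hw]
  set w := I * a / 2 + (I * b) ^ 2 / (4 * (1 / 2 - I * c / 2)) with hwdef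
  have hw0 : (1 : ℂ) / 2 - w ≠ 0 := fun h => by
    have := congrArg Complex.re h
    simp at this
    norm_num at this
    linarith
  have hsqrt : ∀ u : ℂ, ‖u ^ (2⁻¹ : ℂ)‖ ^ 2 = ‖u‖ := fun u => by
    rw [← norm_pow]
    have := cpow_nat_inv_pow u two_ne_zero
    rw [Nat.cast_ofNat] at this
    rw [this]
  have hpi : ‖(Real.sqrt (2 * Real.pi) : ℂ)⁻¹‖ ^ 2 = (2 * Real.pi)⁻¹ := by
    rw [norm_inv, norm_real, inv_pow, Real.norm_eq_abs, sq_abs,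
      Real.sq_sqrt (by positivity)]
  have hprod : (1 - I * a) * (1 - I * c) + (b : ℂ) ^ 2 =
      4 * ((1 / 2 - I * c / 2) * (1 / 2 - w)) := by
    rw [hwdef, mul_pow, I_sq, show (1 - I * c : ℂ) = 2 * (1 / 2 - I * c / 2) by ring]
    clear_value w
    generalize (1 / 2 - I * c / 2 : ℂ) = u at hc0
    field_simp
    ring
  rw [zero_pow two_ne_zero, zero_div, Complex.exp_zero, mul_one, norm_mul, norm_mul, norm_mul,
    mul_pow, mul_pow, mul_pow, hsqrt, hsqrt, hpi, norm_div, norm_div, hprod, norm_mul, norm_mul,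
    norm_real, Real.norm_of_nonneg Real.pi_pos.le]
  have h1 : ‖(1 / 2 - I * c / 2 : ℂ)‖ ≠ 0 := norm_ne_zero_iff.mpr hc0
  have h2 : ‖(1 / 2 - w : ℂ)‖ ≠ 0 := norm_ne_zero_iff.mpr hw0
  have h3 : ‖(4 : ℂ)‖ = 4 := by norm_num
  have h4 := Real.pi_pos.ne'
  rw [h3]
  field_simp
  norm_num

/-! ### Fair coin tosses and the central limit theorem -/

/-- The probability `2^{-N} (N choose k)` of `k` successes among `N` fair coin tosses. -/
noncomputable def coinWeight (N k : ℕ) : ℝ := N.choose k / 2 ^ N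

/-- The number of successes `k` among `N` fair coin tosses, centred and normalized. -/
noncomputable def coinScore (N k : ℕ) : ℝ := (2 * k - N) / Real.sqrt N

theorem coinWeight_nonneg (N k : ℕ) : 0 ≤ coinWeight N k := by
  unfold coinWeight
  positivity

theorem sum_coinWeight (N : ℕ) : ∑ k ∈ Finset.range (N + 1), coinWeight N k = 1 := by
  simp only [coinWeight]
  rw [← Finset.sum_div, ← Nat.cast_sum, Nat.sum_range_choose]
  simp

/-- This is the binomial variance, read off from the Bernstein polynomials at `1/2`. It is 1 for `N
> 0` and 0 for `N = 0`, where the score is 0 by division by zero. It controls the tails. -/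
theorem sum_coinWeight_mul_coinScore_sq_le (N : ℕ) :
    ∑ k ∈ Finset.range (N + 1), coinWeight N k * coinScore N k ^ 2 ≤ 1 := by
  rcases Nat.eq_zero_or_pos N with rfl | hN
  · simp [coinScore]
  have hN' : (0 : ℝ) < N := by exact_mod_cast hN
  have h := congrArg (Polynomial.eval (1 / 2 : ℝ)) (bernsteinPolynomial.variance ℝ N)
  simp only [Polynomial.eval_finsetSum, Polynomial.eval_mul, Polynomial.eval_pow,
    Polynomial.eval_sub, Polynomial.eval_X, Polynomial.eval_natCast,
    Polynomial.eval_one, bernsteinPolynomial, nsmul_eq_mul] at h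
  have h2 : ∑ k ∈ Finset.range (N + 1), coinWeight N k * coinScore N k ^ 2 =
      4 / N * (N * (1 / 2) * (1 - 1 / 2)) := by
    rw [← h, Finset.mul_sum]
    refine Finset.sum_congr rfl fun k hk => ?_
    have hk' : k ≤ N := Nat.lt_succ_iff.mp (Finset.mem_range.mp hk)
    have hp : ((1 : ℝ) / 2) ^ k * (1 - 1 / 2) ^ (N - k) = 1 / 2 ^ N := by
      rw [show (1 : ℝ) - 1 / 2 = 1 / 2 by norm_num, ← pow_add, Nat.add_sub_cancel' hk',
        one_div_pow]
    rw [mul_assoc (N.choose k : ℝ), hp, coinWeight, coinScore, div_pow, Real.sq_sqrt hN'.le]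
    field_simp
    ring
  rw [h2]
  field_simp
  norm_num

open MeasureTheory ProbabilityTheory Filter Topology in
/-- The law of the normalized number of successes among `N` fair coin tosses. -/
noncomputable def coinLaw (N : ℕ) : ProbabilityMeasure ℝ :=
  ⟨(binomial N ⟨1 / 2, by norm_num, by norm_num⟩).map (coinScore N),
    Measure.isProbabilityMeasure_map .of_discrete⟩

open MeasureTheory ProbabilityTheory Filter Topology in
theorem integral_coinLaw (N : ℕ) {f : ℝ → ℂ} (hf : Continuous f) :
    ∫ x, f x ∂(coinLaw N : Measure ℝ) =
      ∑ k ∈ Finset.range (N + 1), (coinWeight N k : ℂ) * f (coinScore N k) := by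
  have h : (coinLaw N : Measure ℝ) =
    (binomial N ⟨1 / 2, by norm_num, by norm_num⟩).map (coinScore N) := rfl
  rw [h, integral_map .of_discrete hf.aestronglyMeasurable, integral_binomial]
  refine Finset.sum_congr (by ext; simp) fun k hk => ?_
  have hk' : k ≤ N := Nat.lt_succ_iff.mp (Finset.mem_range.mp hk)
  rw [Complex.real_smul, coinWeight]
  congr 2
  rw [show (1 : ℝ) - 1 / 2 = 1 / 2 by norm_num, mul_assoc, ← pow_add, Nat.add_sub_cancel' hk',
    one_div_pow, mul_one_div]

open MeasureTheory ProbabilityTheory Filter Topology Complex in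
theorem charFun_coinLaw (N : ℕ) (t : ℝ) :
    charFun (coinLaw N : Measure ℝ) t = Complex.cos ((Real.sqrt N)⁻¹ * t) ^ N := by
  rw [charFun_apply_real, integral_coinLaw N (by fun_prop), Complex.cos, div_pow, add_pow,
    Finset.sum_div]
  refine Finset.sum_congr rfl fun k hk => ?_
  have hk' : k ≤ N := Nat.lt_succ_iff.mp (Finset.mem_range.mp hk)
  rw [coinWeight, coinScore, ← Complex.exp_nat_mul, ← Complex.exp_nat_mul, ← Complex.exp_add]
  have : t * ((2 * k - N) / Real.sqrt N : ℝ) * I = k * ((Real.sqrt N : ℂ)⁻¹ * t * I) +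
      (N - k : ℕ) * (-((Real.sqrt N : ℂ)⁻¹ * t) * I) := by
    push_cast [hk']
    ring
  rw [this]
  push_cast
  ring

open MeasureTheory ProbabilityTheory Filter Topology Complex in
theorem tendsto_coinLaw : Tendsto coinLaw atTop
    (𝓝 (⟨gaussianReal 0 1, inferInstance⟩ : ProbabilityMeasure ℝ)) := by
  refine ProbabilityMeasure.tendsto_of_tendsto_charFun fun t => ?_
  simp only [charFun_coinLaw]
  -- The law of a fair sign has mean 0, variance 1 and characteristic function `cos`; the law of the
  -- score is that of a normalized sum of `N` such signs.
  let r : Measure ℝ := (1 / 2 : ENNReal) • Measure.dirac 1 + (1 / 2 : ENNReal) • Measure.dirac (-1)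
  have hr : IsProbabilityMeasure r := ⟨by simp [r, ENNReal.inv_two_add_inv_two]⟩
  have hint : ∀ (f : ℝ → ℝ), ∫ x, f x ∂r = (f 1 + f (-1)) / 2 := fun f => by
    rw [integral_add_measure, integral_smul_measure, integral_smul_measure, integral_dirac,
      integral_dirac]
    · simp
      ring
    · exact (integrable_dirac (by simp)).smul_measure (by simp)
    · exact (integrable_dirac (by simp)).smul_measure (by simp)
  have hchar : ∀ t, charFun (r.map id) t = Complex.cos t := fun t => by
    rw [Measure.map_id, charFun_apply_real, integral_add_measure, integral_smul_measure,
      integral_smul_measure, integral_dirac, integral_dirac, Complex.cos]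
    · simp
      ring
    · exact (integrable_dirac (by simp)).smul_measure (by simp)
    · exact (integrable_dirac (by simp)).smul_measure (by simp)
  have h := tendsto_charFun_inv_sqrt_mul_pow (P := r) (X := id) aemeasurable_id
    (by rw [hint]; simp) (by rw [hint]; simp) t
  simp only [hchar] at h
  have hg : charFun (gaussianReal 0 1) t = Complex.exp (-(t : ℂ) ^ 2 / 2) := by
    rw [charFun_gaussianReal]
    congr 1
    simp
    ring
  change Tendsto _ _ (𝓝 (charFun (gaussianReal 0 1) t))
  rw [hg]
  exact_mod_cast h

open Complex in
theorem norm_cexp_I_mul_sub_le (a b : ℝ) : ‖cexp (I * a) - cexp (I * b)‖ ≤ |a - b| := by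
  have h : cexp (I * a) - cexp (I * b) = cexp (I * b) * (cexp (I * ((a - b : ℝ) : ℂ)) - 1) := by
    rw [mul_sub, ← Complex.exp_add, mul_one]
    push_cast
    ring_nf
  rw [h, norm_mul, norm_exp_I_mul_ofReal, one_mul]
  exact Real.norm_exp_I_mul_ofReal_sub_one_le

open Complex in
theorem norm_cexp_I_mul_sub_le_two (a b : ℝ) : ‖cexp (I * a) - cexp (I * b)‖ ≤ 2 := by
  refine (norm_sub_le _ _).trans ?_
  rw [norm_exp_I_mul_ofReal, norm_exp_I_mul_ofReal]
  norm_num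

open MeasureTheory ProbabilityTheory Filter Topology Complex in
theorem tendsto_sum_coinWeight {N₁ N₂ : ℕ → ℕ} (h₁ : Tendsto N₁ atTop atTop)
    (h₂ : Tendsto N₂ atTop atTop) {g : ℝ × ℝ → ℂ} (hg : Continuous g) {K : ℝ}
    (hK : ∀ p, ‖g p‖ ≤ K) :
    Tendsto (fun m => ∑ k₁ ∈ Finset.range (N₁ m + 1), ∑ k₂ ∈ Finset.range (N₂ m + 1),
        ((coinWeight (N₁ m) k₁ * coinWeight (N₂ m) k₂ : ℝ) : ℂ) *
          g (coinScore (N₁ m) k₁, coinScore (N₂ m) k₂)) atTop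
      (𝓝 (∫ x, ∫ y, g (x, y) ∂(gaussianReal 0 1) ∂(gaussianReal 0 1))) := by
  have hlim := (ProbabilityMeasure.continuous_prod.tendsto _).comp
    ((tendsto_coinLaw.comp h₁).prodMk_nhds (tendsto_coinLaw.comp h₂))
  have hint : ∀ (μ ν : ProbabilityMeasure ℝ), ∫ p, g p ∂((μ.prod ν : ProbabilityMeasure (ℝ × ℝ)) :
      Measure (ℝ × ℝ)) = ∫ x, ∫ y, g (x, y) ∂(ν : Measure ℝ) ∂(μ : Measure ℝ) := fun μ ν => by
    rw [ProbabilityMeasure.toMeasure_prod, integral_prod]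
    exact Integrable.of_bound hg.aestronglyMeasurable K (ae_of_all _ hK)
  have h := (ProbabilityMeasure.tendsto_iff_forall_integral_rclike_tendsto ℂ).mp hlim
    (BoundedContinuousFunction.ofNormedAddCommGroup g hg K hK)
  simp only [Function.comp_apply, BoundedContinuousFunction.coe_ofNormedAddCommGroup, hint] at h
  have hG := hint ⟨gaussianReal 0 1, inferInstance⟩ ⟨gaussianReal 0 1, inferInstance⟩
  rw [ProbabilityMeasure.coe_mk] at hG
  rw [← hG]
  refine h.congr fun m => ?_
  have hinner : ∀ x, ∫ y, g (x, y) ∂(coinLaw (N₂ m) : Measure ℝ) =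
      ∑ k ∈ Finset.range (N₂ m + 1), (coinWeight (N₂ m) k : ℂ) * g (x, coinScore (N₂ m) k) :=
    fun x => integral_coinLaw _ (by fun_prop)
  simp only [hinner]
  rw [integral_coinLaw _ (by fun_prop)]
  refine Finset.sum_congr rfl fun k₁ _ => ?_
  rw [Finset.mul_sum]
  refine Finset.sum_congr rfl fun k₂ _ => ?_
  push_cast
  ring

open MeasureTheory ProbabilityTheory Filter Topology Complex in
/-- The binomial average of a unimodular function whose phase converges, up to a global phase and
uniformly on bounded windows around the mean, converges in modulus to a Gaussian average. -/
theorem tendsto_norm_sum_coinWeight_cexp {N₁ N₂ : ℕ → ℕ} (h₁ : Tendsto N₁ atTop atTop)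
    (h₂ : Tendsto N₂ atTop atTop) {θ : ℕ → ℕ → ℕ → ℝ} {θ₀ : ℕ → ℝ} {Q : ℝ × ℝ → ℝ}
    (hQ : Continuous Q)
    (h : ∀ R > 0, ∀ ε > 0, ∀ᶠ m in atTop, ∀ k₁ ≤ N₁ m, ∀ k₂ ≤ N₂ m,
      |coinScore (N₁ m) k₁| ≤ R → |coinScore (N₂ m) k₂| ≤ R →
        |θ m k₁ k₂ - θ₀ m - Q (coinScore (N₁ m) k₁, coinScore (N₂ m) k₂)| ≤ ε) :
    Tendsto (fun m => ‖∑ k₁ ∈ Finset.range (N₁ m + 1), ∑ k₂ ∈ Finset.range (N₂ m + 1),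
        ((coinWeight (N₁ m) k₁ * coinWeight (N₂ m) k₂ : ℝ) : ℂ) * cexp (I * θ m k₁ k₂)‖) atTop
      (𝓝 ‖∫ x, ∫ y, cexp (I * Q (x, y)) ∂(gaussianReal 0 1) ∂(gaussianReal 0 1)‖) := by
  have hT := tendsto_sum_coinWeight h₁ h₂ (g := fun p => cexp (I * Q p)) (by fun_prop) (K := 1)
    (fun p => (norm_exp_I_mul_ofReal _).le)
  have hdiff : Tendsto (fun m => ∑ k₁ ∈ Finset.range (N₁ m + 1), ∑ k₂ ∈ Finset.range (N₂ m + 1),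
        ((coinWeight (N₁ m) k₁ * coinWeight (N₂ m) k₂ : ℝ) : ℂ) *
          (cexp (I * (θ m k₁ k₂ - θ₀ m : ℝ)) -
            cexp (I * Q (coinScore (N₁ m) k₁, coinScore (N₂ m) k₂)))) atTop (𝓝 0) := by
    rw [NormedAddGroup.tendsto_nhds_zero]
    intro ε hε
    -- Each of the two tails will cost at most `2/R²`, and the window `ε/4`.
    obtain ⟨R, hR0, hR⟩ : ∃ R : ℝ, 0 < R ∧ 4 / R ^ 2 ≤ ε / 4 := by
      refine ⟨4 / Real.sqrt ε, by positivity, ?_⟩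
      rw [div_pow, Real.sq_sqrt hε.le]
      field_simp
      norm_num
    filter_upwards [h R hR0 (ε / 4) (by positivity)] with m hm
    refine lt_of_le_of_lt ?_ (show ε / 4 + 4 / R ^ 2 < ε by linarith)
    have hterm : ∀ k₁ ∈ Finset.range (N₁ m + 1), ∀ k₂ ∈ Finset.range (N₂ m + 1),
        ‖((coinWeight (N₁ m) k₁ * coinWeight (N₂ m) k₂ : ℝ) : ℂ) *
          (cexp (I * (θ m k₁ k₂ - θ₀ m : ℝ)) -
            cexp (I * Q (coinScore (N₁ m) k₁, coinScore (N₂ m) k₂)))‖ ≤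
        coinWeight (N₁ m) k₁ * coinWeight (N₂ m) k₂ * (ε / 4) +
          2 / R ^ 2 * ((coinWeight (N₁ m) k₁ * coinScore (N₁ m) k₁ ^ 2) * coinWeight (N₂ m) k₂) +
          2 / R ^ 2 * (coinWeight (N₁ m) k₁ *
            (coinWeight (N₂ m) k₂ * coinScore (N₂ m) k₂ ^ 2)) := by
      intro k₁ hk₁ k₂ hk₂
      have hw := mul_nonneg (coinWeight_nonneg (N₁ m) k₁) (coinWeight_nonneg (N₂ m) k₂)
      rw [norm_mul, norm_real, Real.norm_of_nonneg hw]
      -- Inside the window the phases are `ε/4`-close. Outside, the trivial bound 2 is at most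
      -- `2z²/R²` for the score `z` exceeding `R`: Chebyshev's inequality, termwise.
      have hb : ‖cexp (I * (θ m k₁ k₂ - θ₀ m : ℝ)) -
            cexp (I * Q (coinScore (N₁ m) k₁, coinScore (N₂ m) k₂))‖ ≤
          ε / 4 + 2 / R ^ 2 * coinScore (N₁ m) k₁ ^ 2 + 2 / R ^ 2 * coinScore (N₂ m) k₂ ^ 2 := by
        have key : ∀ z : ℝ, R < |z| → 2 ≤ 2 / R ^ 2 * z ^ 2 := fun z hz => by
          have : R ^ 2 ≤ z ^ 2 := by
            rw [← sq_abs z]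
            exact pow_le_pow_left₀ hR0.le hz.le 2
          rw [div_mul_eq_mul_div, le_div_iff₀ (by positivity)]
          linarith
        have hnn : ∀ z : ℝ, 0 ≤ 2 / R ^ 2 * z ^ 2 := fun z => by positivity
        have h1 := hnn (coinScore (N₁ m) k₁)
        have h2 := hnn (coinScore (N₂ m) k₂)
        rcases le_or_gt |coinScore (N₁ m) k₁| R with hz₁ | hz₁
        · rcases le_or_gt |coinScore (N₂ m) k₂| R with hz₂ | hz₂
          · have := (norm_cexp_I_mul_sub_le (θ m k₁ k₂ - θ₀ m)
              (Q (coinScore (N₁ m) k₁, coinScore (N₂ m) k₂))).trans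
              (hm k₁ (Nat.lt_succ_iff.mp (Finset.mem_range.mp hk₁)) k₂
                (Nat.lt_succ_iff.mp (Finset.mem_range.mp hk₂)) hz₁ hz₂)
            linarith
          · have := key _ hz₂
            refine (norm_cexp_I_mul_sub_le_two _ _).trans ?_
            linarith
        · have := key _ hz₁
          refine (norm_cexp_I_mul_sub_le_two _ _).trans ?_
          linarith
      refine (mul_le_mul_of_nonneg_left hb hw).trans (le_of_eq ?_)
      ring
    refine (norm_sum_le_of_le _ fun k₁ hk₁ => norm_sum_le_of_le _ fun k₂ hk₂ =>
      hterm k₁ hk₁ k₂ hk₂).trans ?_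
    simp only [Finset.sum_add_distrib, ← Finset.mul_sum, ← Finset.sum_mul, sum_coinWeight]
    have e₁ := sum_coinWeight_mul_coinScore_sq_le (N₁ m)
    have e₂ := sum_coinWeight_mul_coinScore_sq_le (N₂ m)
    have hR2 : (0 : ℝ) ≤ 2 / R ^ 2 := by positivity
    have f₁ := mul_le_mul_of_nonneg_left e₁ hR2
    have f₂ := mul_le_mul_of_nonneg_left e₂ hR2
    have : (4 : ℝ) / R ^ 2 = 2 / R ^ 2 + 2 / R ^ 2 := by ring
    rw [this]
    simp only [one_mul, mul_one] at *
    linarith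
  have hsum := (hT.add hdiff).norm
  rw [add_zero] at hsum
  refine hsum.congr fun m => ?_
  rw [← Finset.sum_add_distrib]
  simp only [← Finset.sum_add_distrib, ← mul_add, add_sub_cancel]
  -- The reference phase `θ₀ m` does not depend on `k₁, k₂`, so it leaves the sum as a factor of
  -- modulus 1.
  have hphase : ∀ k₁ k₂, cexp (I * (θ m k₁ k₂ - θ₀ m : ℝ)) =
      cexp (I * (-θ₀ m : ℝ)) * cexp (I * θ m k₁ k₂) := fun k₁ k₂ => by
    rw [← Complex.exp_add]
    push_cast
    ring_nf
  simp only [hphase, mul_left_comm _ (cexp (I * (-θ₀ m : ℝ)))]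
  simp only [← Finset.mul_sum]
  rw [norm_mul, norm_exp_I_mul_ofReal, one_mul]

/-! ### Taylor expansion of the leading form and the Hessian of S -/

-- Splitting off the constant coefficient of the shifted polynomial three times gives an exact
-- remainder divisible by `x³`.
open Polynomial in
theorem Polynomial.exists_taylor_cube (p : ℝ[X]) (z : ℝ) :
    ∃ r : ℝ[X], ∀ x, p.eval (z + x) = p.eval z + p.derivative.eval z * x +
      p.derivative.derivative.eval z / 2 * x ^ 2 + x ^ 3 * r.eval x := by
  have hdiv : ∀ q : ℝ[X], ∀ x, q.eval x = q.coeff 0 + x * q.divX.eval x := fun q x => by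
    conv_lhs => rw [← q.divX_mul_X_add]
    simp
    ring
  set q := taylor z p with hq
  refine ⟨q.divX.divX.divX, fun x => ?_⟩
  have h0 : q.coeff 0 = p.eval z := taylor_coeff_zero z p
  have h1 : q.divX.coeff 0 = p.derivative.eval z := by
    rw [coeff_divX, zero_add]
    exact taylor_coeff_one z p
  have h2 : q.divX.divX.coeff 0 = p.derivative.derivative.eval z / 2 := by
    rw [coeff_divX, coeff_divX, zero_add, hq, taylor_coeff]
    have := congrArg (eval z) (congrFun (factorial_smul_hasseDeriv (R := ℝ) (k := 2)) p)
    simp at this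
    linarith
  have hx : p.eval (z + x) = q.eval x := by rw [hq, taylor_eval, add_comm]
  rw [hx, hdiv q, hdiv q.divX, hdiv q.divX.divX, h0, h1, h2]
  ring

namespace QAOA.LeadingForm

open Polynomial

variable {ℓ : ℕ} (F : LeadingForm ℓ)

/-- The factor of the term `μ` that depends on `ξ₁`. -/
noncomputable def factor₁ (μ : Fin F.terms) : ℝ[X] := X ^ F.a μ * (1 - X) ^ F.b μ

/-- The factor of the term `μ` that depends on `ξ₂`. -/
noncomputable def factor₂ (μ : Fin F.terms) : ℝ[X] := X ^ F.c μ * (1 - X) ^ F.d μ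

theorem f_eq_sum_factors (x y : ℝ) :
    F.f x y = ∑ μ, F.κ μ * ((F.factor₁ μ).eval x * (F.factor₂ μ).eval y) := by
  simp only [f, factor₁, factor₂, eval_mul, eval_pow, eval_X, eval_sub, eval_one]
  exact Finset.sum_congr rfl fun μ _ => by ring

/-- The partial derivatives of `f` at `(x, y)`. -/
noncomputable def partialDeriv (i j : ℕ) (x y : ℝ) : ℝ :=
  ∑ μ, F.κ μ * ((derivative^[i] (F.factor₁ μ)).eval x * (derivative^[j] (F.factor₂ μ)).eval y)

theorem hasDerivAt_partialDeriv_fst (i j : ℕ) (x y : ℝ) :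
    HasDerivAt (fun x => F.partialDeriv i j x y) (F.partialDeriv (i + 1) j x y) x := by
  unfold partialDeriv
  refine HasDerivAt.fun_sum fun μ _ => ?_
  rw [Function.iterate_succ_apply']
  exact (((derivative^[i] (F.factor₁ μ)).hasDerivAt x).mul_const _).const_mul _

theorem hasDerivAt_partialDeriv_snd (i j : ℕ) (x y : ℝ) :
    HasDerivAt (fun y => F.partialDeriv i j x y) (F.partialDeriv i (j + 1) x y) y := by
  unfold partialDeriv
  refine HasDerivAt.fun_sum fun μ _ => ?_
  rw [Function.iterate_succ_apply']
  exact (((derivative^[j] (F.factor₂ μ)).hasDerivAt y).const_mul _).const_mul _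

theorem f_eq_partialDeriv : F.f = F.partialDeriv 0 0 := by
  ext x y
  exact F.f_eq_sum_factors x y

theorem eval_half_factor (a b : ℕ) :
    (X ^ a * (1 - X) ^ b : ℝ[X]).eval (1 / 2) = (1 / 2) ^ (a + b) := by
  simp only [eval_mul, eval_pow, eval_X, eval_sub, eval_one]
  rw [pow_add]
  norm_num

theorem eval_half_derivative_factor (a b : ℕ) :
    (derivative (X ^ a * (1 - X) ^ b : ℝ[X])).eval (1 / 2) =
      2 * ((a : ℝ) - b) * (1 / 2) ^ (a + b) := by
  -- The case `n = 0` is separate because `n - 1` is truncated; both sides then vanish.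
  have h : ∀ n : ℕ, (n : ℝ) * (1 / 2) ^ (n - 1) = 2 * n * (1 / 2) ^ n := fun n => by
    rcases n with _ | n
    · simp
    · rw [Nat.add_sub_cancel, pow_succ]
      ring
  simp only [derivative_mul, derivative_pow, derivative_sub, derivative_one,
    derivative_X, eval_add, eval_mul, eval_pow, eval_X, eval_sub, eval_one, eval_C, zero_sub,
    eval_neg]
  rw [show (1 : ℝ) - 1 / 2 = 1 / 2 by norm_num, h, h, pow_add]
  ring

theorem partialDeriv_one_zero : F.partialDeriv 1 0 (1 / 2) (1 / 2) = 2 * (1 / 2) ^ ℓ * F.g₁ := by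
  simp only [partialDeriv, g₁, Finset.mul_sum, Function.iterate_one, Function.iterate_zero, id,
    factor₁, factor₂, eval_half_factor, eval_half_derivative_factor]
  refine Finset.sum_congr rfl fun μ _ => ?_
  have : ((1 : ℝ) / 2) ^ ℓ = (1 / 2) ^ (F.a μ + F.b μ) * (1 / 2) ^ (F.c μ + F.d μ) := by
    rw [← pow_add, ← add_assoc, F.total]
  rw [this]
  ring

theorem partialDeriv_zero_one : F.partialDeriv 0 1 (1 / 2) (1 / 2) = 2 * (1 / 2) ^ ℓ * F.g₂ := by
  simp only [partialDeriv, g₂, Finset.mul_sum, Function.iterate_one, Function.iterate_zero, id,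
    factor₁, factor₂, eval_half_factor, eval_half_derivative_factor]
  refine Finset.sum_congr rfl fun μ _ => ?_
  have : ((1 : ℝ) / 2) ^ ℓ = (1 / 2) ^ (F.a μ + F.b μ) * (1 / 2) ^ (F.c μ + F.d μ) := by
    rw [← pow_add, ← add_assoc, F.total]
  rw [this]
  ring

/-- This identity dictates the value of Γ: the slope `πΓ ∂₁f` offsets the slope `πα₁/2` due to the
mixer, so the balanced point is stationary for the phase. The gradient condition makes the same Γ
serve the second block. -/
theorem Γ_mul_partialDeriv_one_zero {α₁ : ℝ} (h : F.g₁ ≠ 0) :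
    F.Γ α₁ * F.partialDeriv 1 0 (1 / 2) (1 / 2) = -α₁ / 2 := by
  rw [partialDeriv_one_zero, Γ, zpow_sub₀ two_ne_zero, zpow_natCast, one_div_pow]
  field_simp

theorem Γ_mul_partialDeriv_zero_one {α₁ α₂ : ℝ} (h₁ : α₁ ≠ 0) (h₂ : α₂ ≠ 0) (h : F.g₁ ≠ 0)
    (hgrad : F.g₁ / α₁ = F.g₂ / α₂) :
    F.Γ α₁ * F.partialDeriv 0 1 (1 / 2) (1 / 2) = -α₂ / 2 := by
  have hg : F.g₂ = F.g₁ * α₂ / α₁ := by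
    field_simp at hgrad ⊢
    linarith
  rw [partialDeriv_zero_one, Γ, zpow_sub₀ two_ne_zero, zpow_natCast, one_div_pow, hg]
  field_simp

/-- Each term of `f` is a product of one-variable polynomials, so two cubic expansions are
multiplied. Everything beyond the quadratic part has total degree at least 3 in `(x, y)`, hence is
`O(ρ³)` for `ρ ≤ 1`. -/
theorem exists_taylor_bound : ∃ M : ℝ, 0 ≤ M ∧ ∀ x y ρ : ℝ, |x| ≤ ρ → |y| ≤ ρ → ρ ≤ 1 →
    |F.f (1 / 2 + x) (1 / 2 + y) - (F.partialDeriv 0 0 (1 / 2) (1 / 2) +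
      F.partialDeriv 1 0 (1 / 2) (1 / 2) * x + F.partialDeriv 0 1 (1 / 2) (1 / 2) * y +
      (F.partialDeriv 2 0 (1 / 2) (1 / 2) * x ^ 2 / 2 +
        F.partialDeriv 1 1 (1 / 2) (1 / 2) * x * y +
        F.partialDeriv 0 2 (1 / 2) (1 / 2) * y ^ 2 / 2))| ≤ M * ρ ^ 3 := by
  choose r hr using fun μ => (F.factor₁ μ).exists_taylor_cube (1 / 2)
  choose t ht using fun μ => (F.factor₂ μ).exists_taylor_cube (1 / 2)
  have hbound : ∀ p : ℝ[X], ∃ K : ℝ, 0 ≤ K ∧ ∀ x : ℝ, |x| ≤ 1 → |p.eval x| ≤ K := fun p => by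
    obtain ⟨K, hK⟩ := (isCompact_Icc (a := (-1 : ℝ)) (b := 1)).exists_bound_of_continuousOn
      p.continuousOn
    exact ⟨max K 0, le_max_right _ _, fun x hx => (hK x (abs_le.mp hx)).trans (le_max_left _ _)⟩
  have hterm : ∀ μ, ∃ M : ℝ, 0 ≤ M ∧ ∀ x y ρ : ℝ, |x| ≤ ρ → |y| ≤ ρ → ρ ≤ 1 →
      |(F.factor₁ μ).eval (1 / 2 + x) * (F.factor₂ μ).eval (1 / 2 + y) -
        ((F.factor₁ μ).eval (1 / 2) * (F.factor₂ μ).eval (1 / 2) +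
          (derivative (F.factor₁ μ)).eval (1 / 2) * (F.factor₂ μ).eval (1 / 2) * x +
          (F.factor₁ μ).eval (1 / 2) * (derivative (F.factor₂ μ)).eval (1 / 2) * y +
          ((derivative (derivative (F.factor₁ μ))).eval (1 / 2) *
              (F.factor₂ μ).eval (1 / 2) * x ^ 2 / 2 +
            (derivative (F.factor₁ μ)).eval (1 / 2) *
              (derivative (F.factor₂ μ)).eval (1 / 2) * x * y +
            (F.factor₁ μ).eval (1 / 2) *
              (derivative (derivative (F.factor₂ μ))).eval (1 / 2) * y ^ 2 / 2))| ≤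
        M * ρ ^ 3 := by
    intro μ
    obtain ⟨K₁, hK₁0, hK₁⟩ := hbound (r μ)
    obtain ⟨K₂, hK₂0, hK₂⟩ := hbound (t μ)
    obtain ⟨K₃, hK₃0, hK₃⟩ := hbound ((F.factor₂ μ).comp (C (1 / 2) + X))
    set p₀ := (F.factor₁ μ).eval (1 / 2)
    set p₁ := (derivative (F.factor₁ μ)).eval (1 / 2)
    set p₂ := (derivative (derivative (F.factor₁ μ))).eval (1 / 2)
    set q₀ := (F.factor₂ μ).eval (1 / 2)
    set q₁ := (derivative (F.factor₂ μ)).eval (1 / 2)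
    set q₂ := (derivative (derivative (F.factor₂ μ))).eval (1 / 2)
    refine ⟨K₁ * K₃ + (|p₀| + |p₁| + |p₂ / 2|) * K₂ + |p₂ / 2 * q₁| + |p₁ * (q₂ / 2)| +
      |p₂ / 2 * (q₂ / 2)|, by positivity, fun x y ρ hx hy hρ => ?_⟩
    have hρ0 : 0 ≤ ρ := (abs_nonneg x).trans hx
    have hmon : ∀ i j : ℕ, 3 ≤ i + j → |x ^ i * y ^ j| ≤ ρ ^ 3 := fun i j hij => by
      rw [abs_mul, abs_pow, abs_pow]
      calc |x| ^ i * |y| ^ j ≤ ρ ^ i * ρ ^ j :=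
            mul_le_mul (pow_le_pow_left₀ (abs_nonneg _) hx _)
              (pow_le_pow_left₀ (abs_nonneg _) hy _) (by positivity) (by positivity)
        _ = ρ ^ (i + j) := (pow_add _ _ _).symm
        _ ≤ ρ ^ 3 := pow_le_pow_of_le_one hρ0 hρ hij
    have hprod : ∀ {u v A B : ℝ}, |u| ≤ A → |v| ≤ B → |u * v| ≤ A * B := fun hu hv => by
      rw [abs_mul]
      exact mul_le_mul hu hv (abs_nonneg _) ((abs_nonneg _).trans hu)
    have e₃ : |(F.factor₂ μ).eval (1 / 2 + y)| ≤ K₃ := by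
      have := hK₃ y (hy.trans hρ)
      rwa [eval_comp, eval_add, eval_C, eval_X] at this
    have hp : |p₀ + p₁ * x + p₂ / 2 * x ^ 2| ≤ |p₀| + |p₁| + |p₂ / 2| := by
      have hx1 := hx.trans hρ
      have hx2 : |x ^ 2| ≤ 1 := by rw [abs_pow]; exact pow_le_one₀ (abs_nonneg x) hx1
      refine (abs_add_three _ _ _).trans ?_
      have h1 := hprod (le_refl |p₁|) hx1
      have h2 := hprod (le_refl |p₂ / 2|) hx2
      linarith
    have t₁ : |(r μ).eval x * (F.factor₂ μ).eval (1 / 2 + y) * (x ^ 3 * y ^ 0)| ≤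
        K₁ * K₃ * ρ ^ 3 := hprod (hprod (hK₁ x (hx.trans hρ)) e₃) (hmon 3 0 le_rfl)
    have t₂ : |(p₀ + p₁ * x + p₂ / 2 * x ^ 2) * (t μ).eval y * (x ^ 0 * y ^ 3)| ≤
        (|p₀| + |p₁| + |p₂ / 2|) * K₂ * ρ ^ 3 :=
      hprod (hprod hp (hK₂ y (hy.trans hρ))) (hmon 0 3 le_rfl)
    have t₃ : |p₂ / 2 * q₁ * (x ^ 2 * y ^ 1)| ≤ |p₂ / 2 * q₁| * ρ ^ 3 :=
      hprod le_rfl (hmon 2 1 le_rfl)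
    have t₄ : |p₁ * (q₂ / 2) * (x ^ 1 * y ^ 2)| ≤ |p₁ * (q₂ / 2)| * ρ ^ 3 :=
      hprod le_rfl (hmon 1 2 le_rfl)
    have t₅ : |p₂ / 2 * (q₂ / 2) * (x ^ 2 * y ^ 2)| ≤ |p₂ / 2 * (q₂ / 2)| * ρ ^ 3 :=
      hprod le_rfl (hmon 2 2 (by norm_num))
    have hsplit : (F.factor₁ μ).eval (1 / 2 + x) * (F.factor₂ μ).eval (1 / 2 + y) -
        (p₀ * q₀ + p₁ * q₀ * x + p₀ * q₁ * y +
          (p₂ * q₀ * x ^ 2 / 2 + p₁ * q₁ * x * y + p₀ * q₂ * y ^ 2 / 2)) =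
        (r μ).eval x * (F.factor₂ μ).eval (1 / 2 + y) * (x ^ 3 * y ^ 0) +
        (p₀ + p₁ * x + p₂ / 2 * x ^ 2) * (t μ).eval y * (x ^ 0 * y ^ 3) +
        p₂ / 2 * q₁ * (x ^ 2 * y ^ 1) + p₁ * (q₂ / 2) * (x ^ 1 * y ^ 2) +
        p₂ / 2 * (q₂ / 2) * (x ^ 2 * y ^ 2) := by
      rw [hr μ x, ht μ y]
      ring
    rw [hsplit]
    rw [abs_le] at t₁ t₂ t₃ t₄ t₅ ⊢
    constructor <;> linarith
  choose M hM0 hM using hterm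
  refine ⟨∑ μ, |F.κ μ| * M μ, Finset.sum_nonneg fun μ _ => mul_nonneg (abs_nonneg _) (hM0 μ),
    fun x y ρ hx hy hρ => ?_⟩
  rw [f_eq_sum_factors]
  simp only [partialDeriv, Finset.sum_mul, Finset.sum_div, ← Finset.sum_add_distrib,
    ← Finset.sum_sub_distrib]
  refine (Finset.abs_sum_le_sum_abs _ _).trans (Finset.sum_le_sum fun μ _ => ?_)
  rw [mul_assoc |F.κ μ|]
  refine le_trans (le_of_eq ?_)
    (mul_le_mul_of_nonneg_left (hM μ x y ρ hx hy hρ) (abs_nonneg (F.κ μ)))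
  rw [← abs_mul]
  simp only [Function.iterate_zero, Function.iterate_succ, Function.comp_apply, id]
  ring_nf

theorem hasDerivAt_S_fst (α₁ α₂ : ℝ) {x : ℝ} (hx0 : x ≠ 0) (hx1 : x ≠ 1) (y : ℝ) :
    HasDerivAt (fun x => F.S α₁ α₂ x y)
      (((α₁ * (Real.log (1 - x) - Real.log x) : ℝ) : ℂ) +
        Complex.I * ((Real.pi / 2 * α₁ + Real.pi * F.Γ α₁ * F.partialDeriv 1 0 x y : ℝ) : ℂ))
      x := by
  unfold S
  refine HasDerivAt.add (HasDerivAt.ofReal_comp ?_)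
    (HasDerivAt.const_mul _ (HasDerivAt.ofReal_comp ?_))
  · exact ((Real.hasDerivAt_binEntropy hx0 hx1).const_mul α₁).add_const _ |>.sub_const _
  · rw [f_eq_partialDeriv]
    refine HasDerivAt.add ?_ ((F.hasDerivAt_partialDeriv_fst 0 0 x y).const_mul _)
    simpa using (((hasDerivAt_id x).const_mul α₁).add_const (α₂ * y)).const_mul (Real.pi / 2)

theorem hasDerivAt_S_snd (α₁ α₂ : ℝ) (x : ℝ) {y : ℝ} (hy0 : y ≠ 0) (hy1 : y ≠ 1) :
    HasDerivAt (fun y => F.S α₁ α₂ x y)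
      (((α₂ * (Real.log (1 - y) - Real.log y) : ℝ) : ℂ) +
        Complex.I * ((Real.pi / 2 * α₂ + Real.pi * F.Γ α₁ * F.partialDeriv 0 1 x y : ℝ) : ℂ))
      y := by
  unfold S
  refine HasDerivAt.add (HasDerivAt.ofReal_comp ?_)
    (HasDerivAt.const_mul _ (HasDerivAt.ofReal_comp ?_))
  · exact ((Real.hasDerivAt_binEntropy hy0 hy1).const_mul α₂).const_add _ |>.sub_const _
  · rw [f_eq_partialDeriv]
    refine HasDerivAt.add ?_ ((F.hasDerivAt_partialDeriv_snd 0 0 x y).const_mul _)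
    simpa using (((hasDerivAt_id y).const_mul α₂).const_add (α₁ * x)).const_mul (Real.pi / 2)

theorem hasDerivAt_logit_half (α : ℝ) :
    HasDerivAt (fun x : ℝ => α * (Real.log (1 - x) - Real.log x)) (-4 * α) (1 / 2) := by
  have h1 : HasDerivAt (fun x : ℝ => Real.log (1 - x)) (-1 / (1 - 1 / 2)) (1 / 2) :=
    ((hasDerivAt_id (1 / 2 : ℝ)).const_sub 1).log (by norm_num)
  have h2 := Real.hasDerivAt_log (x := 1 / 2) (by norm_num)
  refine ((h1.sub h2).const_mul α).congr_deriv ?_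
  norm_num
  ring

theorem hessianS_eq (α₁ α₂ : ℝ) : F.hessianS α₁ α₂ =
    !![-4 * (α₁ : ℂ) + Complex.I * (Real.pi * F.Γ α₁ * F.partialDeriv 2 0 (1 / 2) (1 / 2) : ℝ),
        Complex.I * (Real.pi * F.Γ α₁ * F.partialDeriv 1 1 (1 / 2) (1 / 2) : ℝ);
      Complex.I * (Real.pi * F.Γ α₁ * F.partialDeriv 1 1 (1 / 2) (1 / 2) : ℝ),
        -4 * (α₂ : ℂ) + Complex.I * (Real.pi * F.Γ α₁ * F.partialDeriv 0 2 (1 / 2) (1 / 2) : ℝ)] := by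
  -- The entropy derivative is used only away from 0 and 1, so the pure second derivatives are
  -- computed from an identity valid near `1/2`.
  have hnhds : ∀ᶠ x in nhds (1 / 2 : ℝ), x ≠ 0 ∧ x ≠ 1 :=
    (eventually_ne_nhds (by norm_num)).and (eventually_ne_nhds (by norm_num))
  have h₁₁ : deriv (fun x => deriv (fun x' => F.S α₁ α₂ x' (1 / 2)) x) (1 / 2) =
      -4 * (α₁ : ℂ) +
        Complex.I * (Real.pi * F.Γ α₁ * F.partialDeriv 2 0 (1 / 2) (1 / 2) : ℝ) := by
    have heq : (fun x => deriv (fun x' => F.S α₁ α₂ x' (1 / 2)) x) =ᶠ[nhds (1 / 2)] fun x =>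
        ((α₁ * (Real.log (1 - x) - Real.log x) : ℝ) : ℂ) + Complex.I *
          ((Real.pi / 2 * α₁ + Real.pi * F.Γ α₁ * F.partialDeriv 1 0 x (1 / 2) : ℝ) : ℂ) :=
      hnhds.mono fun x hx => (F.hasDerivAt_S_fst α₁ α₂ hx.1 hx.2 (1 / 2)).deriv
    rw [heq.deriv_eq]
    have h := (hasDerivAt_logit_half α₁).ofReal_comp.add
      ((((F.hasDerivAt_partialDeriv_fst 1 0 (1 / 2) (1 / 2)).const_mul
        (Real.pi * F.Γ α₁)).const_add (Real.pi / 2 * α₁)).ofReal_comp.const_mul Complex.I)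
    refine h.deriv.trans ?_
    push_cast
    ring
  have h₂₂ : deriv (fun y => deriv (fun y' => F.S α₁ α₂ (1 / 2) y') y) (1 / 2) =
      -4 * (α₂ : ℂ) +
        Complex.I * (Real.pi * F.Γ α₁ * F.partialDeriv 0 2 (1 / 2) (1 / 2) : ℝ) := by
    have heq : (fun y => deriv (fun y' => F.S α₁ α₂ (1 / 2) y') y) =ᶠ[nhds (1 / 2)] fun y =>
        ((α₂ * (Real.log (1 - y) - Real.log y) : ℝ) : ℂ) + Complex.I *
          ((Real.pi / 2 * α₂ + Real.pi * F.Γ α₁ * F.partialDeriv 0 1 (1 / 2) y : ℝ) : ℂ) :=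
      hnhds.mono fun y hy => (F.hasDerivAt_S_snd α₁ α₂ (1 / 2) hy.1 hy.2).deriv
    rw [heq.deriv_eq]
    have h := (hasDerivAt_logit_half α₂).ofReal_comp.add
      ((((F.hasDerivAt_partialDeriv_snd 0 1 (1 / 2) (1 / 2)).const_mul
        (Real.pi * F.Γ α₁)).const_add (Real.pi / 2 * α₂)).ofReal_comp.const_mul Complex.I)
    refine h.deriv.trans ?_
    push_cast
    ring
  have h₁₂ : deriv (fun x => deriv (fun y => F.S α₁ α₂ x y) (1 / 2)) (1 / 2) =
      Complex.I * (Real.pi * F.Γ α₁ * F.partialDeriv 1 1 (1 / 2) (1 / 2) : ℝ) := by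
    have heq : (fun x => deriv (fun y => F.S α₁ α₂ x y) (1 / 2)) = fun x =>
        ((α₂ * (Real.log (1 - 1 / 2) - Real.log (1 / 2)) : ℝ) : ℂ) + Complex.I *
          ((Real.pi / 2 * α₂ + Real.pi * F.Γ α₁ * F.partialDeriv 0 1 x (1 / 2) : ℝ) : ℂ) :=
      funext fun x => (F.hasDerivAt_S_snd α₁ α₂ x (by norm_num) (by norm_num)).deriv
    rw [heq]
    exact (((((F.hasDerivAt_partialDeriv_fst 0 1 (1 / 2) (1 / 2)).const_mul
        (Real.pi * F.Γ α₁)).const_add (Real.pi / 2 * α₂)).ofReal_comp.const_mul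
          Complex.I).const_add _).deriv
  have h₂₁ : deriv (fun y => deriv (fun x => F.S α₁ α₂ x y) (1 / 2)) (1 / 2) =
      Complex.I * (Real.pi * F.Γ α₁ * F.partialDeriv 1 1 (1 / 2) (1 / 2) : ℝ) := by
    have heq : (fun y => deriv (fun x => F.S α₁ α₂ x y) (1 / 2)) = fun y =>
        ((α₁ * (Real.log (1 - 1 / 2) - Real.log (1 / 2)) : ℝ) : ℂ) + Complex.I *
          ((Real.pi / 2 * α₁ + Real.pi * F.Γ α₁ * F.partialDeriv 1 0 (1 / 2) y : ℝ) : ℂ) :=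
      funext fun y => (F.hasDerivAt_S_fst α₁ α₂ (by norm_num) (by norm_num) y).deriv
    rw [heq]
    exact (((((F.hasDerivAt_partialDeriv_snd 1 0 (1 / 2) (1 / 2)).const_mul
        (Real.pi * F.Γ α₁)).const_add (Real.pi / 2 * α₁)).ofReal_comp.const_mul
          Complex.I).const_add _).deriv
  rw [hessianS, h₁₁, h₁₂, h₂₁, h₂₂]

end QAOA.LeadingForm

/-! ### From the amplitude to the limiting phase -/

namespace QAOA

open Complex in
theorem state_quarter_eq_sum_coinWeight {n₁ n₂ : ℕ} {C : BitString (Fin n₁ ⊕ Fin n₂) → ℝ}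
    {s : BitString (Fin n₁ ⊕ Fin n₂)} {c : ℕ → ℕ → ℝ}
    (hc : ∀ x, C x = c (dist₁ x s) (dist₂ x s)) (γ : ℝ) :
    state C (-(Real.pi / 4)) γ s =
      ∑ k₁ ∈ Finset.range (n₁ + 1), ∑ k₂ ∈ Finset.range (n₂ + 1),
        ((coinWeight n₁ k₁ * coinWeight n₂ k₂ : ℝ) : ℂ) *
          cexp (I * (γ * c k₁ k₂ - Real.pi / 2 * (k₁ + k₂) : ℝ)) := by
  have hI : cexp (-(Real.pi / 2 * I)) = -I := by
    rw [Complex.exp_neg, exp_pi_div_two_mul_I, inv_I]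
  have hexp : ∀ k₁ k₂ : ℕ, (-I) ^ (k₁ + k₂) * cexp (I * γ * c k₁ k₂) =
      cexp (I * (γ * c k₁ k₂ - Real.pi / 2 * (k₁ + k₂) : ℝ)) := fun k₁ k₂ => by
    rw [← hI, ← Complex.exp_nat_mul, ← Complex.exp_add]
    push_cast
    ring_nf
  rw [state_quarter_apply]
  simp only [hc, hammingDist_eq_dist₁_add_dist₂]
  rw [sum_dist₁_dist₂ s (fun k₁ k₂ => (-I) ^ (k₁ + k₂) * cexp (I * γ * c k₁ k₂)),
    Finset.mul_sum]
  refine Finset.sum_congr rfl fun k₁ _ => ?_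
  rw [nsmul_eq_mul, Finset.mul_sum, Finset.mul_sum]
  refine Finset.sum_congr rfl fun k₂ _ => ?_
  rw [hexp, nsmul_eq_mul, Fintype.card_sum, Fintype.card_fin, Fintype.card_fin, coinWeight,
    coinWeight, pow_add, one_div_pow, one_div_pow]
  push_cast
  ring

/-- The subleading part of a symmetric local cost, as a function of the block distances, is
Lipschitz with a constant of order `1 / n`. -/
theorem exists_residual_lipschitz {ℓ : ℕ} (F : LeadingForm ℓ) (L : ℕ) :
    ∃ A : ℝ, 0 ≤ A ∧ ∀ {n₁ n₂ : ℕ} {c : ℕ → ℕ → ℝ} {u v K : ℝ},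
      L + ℓ + 1 ≤ n₁ → L + ℓ + 1 ≤ n₂ →
      (∀ k₁ k₂, k₁ + (L + 1) ≤ n₁ → k₂ ≤ n₂ →
        ∑ j ∈ Finset.range (L + 2), ((L + 1).choose j : ℝ) * ((-1) ^ j * c (k₁ + j) k₂) = 0) →
      (∀ k₁ k₂, k₁ ≤ n₁ → k₂ + (L + 1) ≤ n₂ →
        ∑ j ∈ Finset.range (L + 2), ((L + 1).choose j : ℝ) * ((-1) ^ j * c k₁ (k₂ + j)) = 0) →
      (∀ k₁ ≤ n₁, ∀ k₂ ≤ n₂, |c k₁ k₂ * u - v * F.f (k₁ / n₁) (k₂ / n₂)| ≤ K) →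
      ∀ k₁ ≤ n₁, ∀ k₂ ≤ n₂, ∀ k₁' ≤ n₁, ∀ k₂' ≤ n₂,
        |(c k₁ k₂ * u - v * F.f (k₁ / n₁) (k₂ / n₂)) -
          (c k₁' k₂' * u - v * F.f (k₁' / n₁) (k₂' / n₂))| ≤
        A * K * (|(k₁ : ℝ) - k₁'| / n₁ + |(k₂ : ℝ) - k₂'| / n₂) := by
  obtain ⟨A, hA0, hA⟩ := exists_lipschitz_bound_of_bounded_on_range (L + ℓ + 1) (by omega)
  refine ⟨A, hA0, fun {n₁ n₂ c u v K} hn₁ hn₂ hc₁ hc₂ hK k₁ hk₁ k₂ hk₂ k₁' hk₁' k₂' hk₂' => ?_⟩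
  -- Degrees are at most `L` for the cost and `ℓ` for `f`; the extra 1 guarantees the positive
  -- degree bound that the Lipschitz lemma requires.
  have hdeg : ∀ (p q : Polynomial ℝ) (n : ℕ), p.natDegree ≤ L → q.natDegree ≤ ℓ →
      (p * Polynomial.C u - Polynomial.C v *
        q.comp (Polynomial.C (1 / (n : ℝ)) * Polynomial.X)).natDegree ≤ L + ℓ + 1 := by
    intro p q n hp hq
    refine (Polynomial.natDegree_sub_le _ _).trans (max_le ?_ ?_)
    · exact (Polynomial.natDegree_mul_C_le _ _).trans (by omega)
    · refine (Polynomial.natDegree_C_mul_le _ _).trans (Polynomial.natDegree_comp_le.trans ?_)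
      have h1 : (Polynomial.C (1 / (n : ℝ)) * Polynomial.X).natDegree ≤ 1 := by compute_degree
      have := Nat.mul_le_mul hq h1
      omega
  have hstep₁ : |(c k₁ k₂ * u - v * F.f (k₁ / n₁) (k₂ / n₂)) -
      (c k₁' k₂ * u - v * F.f (k₁' / n₁) (k₂ / n₂))| ≤ A * K * (|(k₁ : ℝ) - k₁'| / n₁) := by
    obtain ⟨p, hp, hpe⟩ := exists_polynomial_of_alternating_sum_eq_zero
      (c := fun k => c k k₂) (fun k hk => hc₁ k k₂ hk hk₂)
    obtain ⟨q, hq, hqe⟩ := F.exists_polynomial_fst (k₂ / n₂)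
    have heval : ∀ k ≤ n₁, c k k₂ * u - v * F.f (k / n₁) (k₂ / n₂) =
        (p * Polynomial.C u - Polynomial.C v *
          q.comp (Polynomial.C (1 / (n₁ : ℝ)) * Polynomial.X)).eval (k : ℝ) := fun k hk => by
      rw [hqe]
      simp [hpe k hk, div_eq_inv_mul]
    rw [heval k₁ hk₁, heval k₁' hk₁']
    exact hA n₁ _ K hn₁ (hdeg p q n₁ hp hq)
      (fun k hk => by rw [← heval k hk]; exact hK k hk k₂ hk₂) k₁ hk₁ k₁' hk₁'
  have hstep₂ : |(c k₁' k₂ * u - v * F.f (k₁' / n₁) (k₂ / n₂)) -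
      (c k₁' k₂' * u - v * F.f (k₁' / n₁) (k₂' / n₂))| ≤ A * K * (|(k₂ : ℝ) - k₂'| / n₂) := by
    obtain ⟨p, hp, hpe⟩ := exists_polynomial_of_alternating_sum_eq_zero
      (c := fun k => c k₁' k) (fun k hk => hc₂ k₁' k hk₁' hk)
    obtain ⟨q, hq, hqe⟩ := F.exists_polynomial_snd (k₁' / n₁)
    have heval : ∀ k ≤ n₂, c k₁' k * u - v * F.f (k₁' / n₁) (k / n₂) =
        (p * Polynomial.C u - Polynomial.C v *
          q.comp (Polynomial.C (1 / (n₂ : ℝ)) * Polynomial.X)).eval (k : ℝ) := fun k hk => by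
      rw [hqe]
      simp [hpe k hk, div_eq_inv_mul]
    rw [heval k₂ hk₂, heval k₂' hk₂']
    exact hA n₂ _ K hn₂ (hdeg p q n₂ hp hq)
      (fun k hk => by rw [← heval k hk]; exact hK k₁' hk₁' k hk) k₂ hk₂ k₂' hk₂'
  -- One distance is moved at a time, through the corner `(k₁', k₂)`.
  refine (abs_sub_le _ (c k₁' k₂ * u - v * F.f (k₁' / n₁) (k₂ / n₂)) _).trans ?_
  rw [mul_add]
  exact add_le_add hstep₁ hstep₂

namespace LeadingForm

variable {ℓ : ℕ} (F : LeadingForm ℓ)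

/-- The quadratic phase in the normalized block distances that survives in the limit. -/
noncomputable def limitPhase (α₁ α₂ : ℝ) (z : ℝ × ℝ) : ℝ :=
  -(Real.pi * F.Γ α₁ * F.partialDeriv 2 0 (1 / 2) (1 / 2) / (4 * α₁)) * z.1 ^ 2 / 2 +
    -(Real.pi * F.Γ α₁ * F.partialDeriv 1 1 (1 / 2) (1 / 2) / (4 * (√α₁ * √α₂))) * z.1 * z.2 +
    -(Real.pi * F.Γ α₁ * F.partialDeriv 0 2 (1 / 2) (1 / 2) / (4 * α₂)) * z.2 ^ 2 / 2

theorem continuous_limitPhase (α₁ α₂ : ℝ) : Continuous (F.limitPhase α₁ α₂) := by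
  unfold limitPhase
  fun_prop

/-- A vanishing imaginary part forces `c = -a`, and the real part is then `1 + a² + b² > 0`. -/
theorem limit_factor_ne_zero (a b c : ℝ) :
    (1 - Complex.I * a) * (1 - Complex.I * c) + (b : ℂ) ^ 2 ≠ 0 := by
  intro h
  have hre := congrArg Complex.re h
  have him := congrArg Complex.im h
  simp [pow_two] at hre him
  have hc : c = -a := by linarith
  subst hc
  nlinarith [sq_nonneg a, sq_nonneg b]

/-- With `D = diag(α₁, α₂)` and `A` the matrix of `limitPhase`, `H_S = -4 D^{1/2} (1 + iA) D^{1/2}`.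
The Gaussian average produces `det(1 - iA)`, the complex conjugate of `det(1 + iA)`, which has the
same modulus. -/
theorem norm_det_hessianS {α₁ α₂ : ℝ} (hα₁ : 0 < α₁) (hα₂ : 0 < α₂) :
    ‖(F.hessianS α₁ α₂).det‖ = 16 * α₁ * α₂ *
      ‖(1 - Complex.I * (-(Real.pi * F.Γ α₁ * F.partialDeriv 2 0 (1 / 2) (1 / 2) / (4 * α₁)) : ℝ)) *
        (1 - Complex.I * (-(Real.pi * F.Γ α₁ * F.partialDeriv 0 2 (1 / 2) (1 / 2) /
          (4 * α₂)) : ℝ)) +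
        ((-(Real.pi * F.Γ α₁ * F.partialDeriv 1 1 (1 / 2) (1 / 2) /
          (4 * (√α₁ * √α₂))) : ℝ) : ℂ) ^ 2‖ := by
  rw [hessianS_eq, Matrix.det_fin_two_of]
  generalize Real.pi * F.Γ α₁ * F.partialDeriv 2 0 (1 / 2) (1 / 2) = p
  generalize Real.pi * F.Γ α₁ * F.partialDeriv 1 1 (1 / 2) (1 / 2) = q
  generalize Real.pi * F.Γ α₁ * F.partialDeriv 0 2 (1 / 2) (1 / 2) = r
  have h16 : (16 * α₁ * α₂ : ℝ) = ‖((16 * α₁ * α₂ : ℝ) : ℂ)‖ := by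
    rw [Complex.norm_real, Real.norm_of_nonneg (by positivity)]
  rw [h16, ← norm_mul, ← Complex.norm_conj]
  congr 1
  have hb : ((-(q / (4 * (√α₁ * √α₂))) : ℝ) : ℂ) ^ 2 = ((q ^ 2 / (16 * (α₁ * α₂)) : ℝ) : ℂ) := by
    rw [← Complex.ofReal_pow]
    congr 1
    rw [neg_sq, div_pow, mul_pow, mul_pow, Real.sq_sqrt hα₁.le, Real.sq_sqrt hα₂.le]
    norm_num
  have h₁ : (α₁ : ℂ) ≠ 0 := by exact_mod_cast hα₁.ne'
  have h₂ : (α₂ : ℂ) ≠ 0 := by exact_mod_cast hα₂.ne'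
  rw [hb]
  simp only [map_sub, map_mul, map_add, Complex.conj_I, Complex.conj_ofReal, map_neg, map_ofNat]
  push_cast
  field_simp
  ring_nf
  simp only [Complex.I_sq]
  ring

theorem norm_integral_limitPhase {α₁ α₂ : ℝ} (hα₁ : 0 < α₁) (hα₂ : 0 < α₂) :
    ‖∫ x, ∫ y, Complex.exp (Complex.I * F.limitPhase α₁ α₂ (x, y))
        ∂(ProbabilityTheory.gaussianReal 0 1) ∂(ProbabilityTheory.gaussianReal 0 1)‖ ^ 2 =
      16 * α₁ * α₂ / ‖(F.hessianS α₁ α₂).det‖ := by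
  unfold limitPhase
  rw [norm_integral_gaussianReal_cexp_quadratic_form, norm_det_hessianS F hα₁ hα₂,
    div_mul_cancel_left₀ (by positivity), one_div]

theorem norm_det_hessianS_pos {α₁ α₂ : ℝ} (hα₁ : 0 < α₁) (hα₂ : 0 < α₂) :
    0 < ‖(F.hessianS α₁ α₂).det‖ := by
  rw [norm_det_hessianS F hα₁ hα₂]
  exact mul_pos (by positivity) (norm_pos_iff.mpr (limit_factor_ne_zero _ _ _))

theorem eq_add_mul_coinScore {n : ℕ} (hn : (0 : ℝ) < n) (k : ℕ) :
    (k : ℝ) = n / 2 + n * (coinScore n k / (2 * √n)) := by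
  have hs : 0 < √(n : ℝ) := Real.sqrt_pos.mpr hn
  have h : (n : ℝ) * (coinScore n k / (2 * √n)) = n / (√n * √n) * ((2 * k - n) / 2) := by
    rw [coinScore]
    field_simp
  rw [h, Real.mul_self_sqrt hn.le, div_self hn.ne']
  ring

/-- Near the balanced point, the leading-order phase is a constant plus `limitPhase`. -/
theorem exists_phase_bound {α₁ α₂ : ℝ} (hα₁ : 0 < α₁) (hα₂ : 0 < α₂) (hg : F.g₁ ≠ 0)
    (hgrad : F.g₁ / α₁ = F.g₂ / α₂) :
    ∃ M : ℝ, 0 ≤ M ∧ ∀ {n₁ n₂ : ℕ} {N R ρ : ℝ}, 0 < N → (n₁ : ℝ) = α₁ * N →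
      (n₂ : ℝ) = α₂ * N → ρ = R * (1 / √α₁ + 1 / √α₂) / √N → ρ ≤ 1 →
      ∀ k₁ k₂ : ℕ, |coinScore n₁ k₁| ≤ R → |coinScore n₂ k₂| ≤ R →
        |(k₁ : ℝ) / n₁ - 1 / 2| ≤ ρ ∧ |(k₂ : ℝ) / n₂ - 1 / 2| ≤ ρ ∧
        |-(Real.pi * F.Γ α₁) * (N * F.f (k₁ / n₁) (k₂ / n₂)) - Real.pi / 2 * (k₁ + k₂) -
          (-(Real.pi * F.Γ α₁) * (N * F.partialDeriv 0 0 (1 / 2) (1 / 2)) -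
            Real.pi / 4 * (n₁ + n₂)) -
          F.limitPhase α₁ α₂ (coinScore n₁ k₁, coinScore n₂ k₂)| ≤ M * (N * ρ ^ 3) := by
  obtain ⟨M, hM0, hM⟩ := F.exists_taylor_bound
  refine ⟨|Real.pi * F.Γ α₁| * M, mul_nonneg (abs_nonneg _) hM0,
    fun {n₁ n₂ N R ρ} hN hn₁ hn₂ hρ hρ1 k₁ k₂ hk₁ hk₂ => ?_⟩
  have hJ₁ := F.Γ_mul_partialDeriv_one_zero (α₁ := α₁) hg
  have hJ₂ := F.Γ_mul_partialDeriv_zero_one hα₁.ne' hα₂.ne' hg hgrad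
  have hsN : 0 < √N := Real.sqrt_pos.mpr hN
  have hs₁ : 0 < √α₁ := Real.sqrt_pos.mpr hα₁
  have hs₂ : 0 < √α₂ := Real.sqrt_pos.mpr hα₂
  have hsqrt₁ : √(n₁ : ℝ) = √α₁ * √N := by rw [hn₁, Real.sqrt_mul hα₁.le]
  have hsqrt₂ : √(n₂ : ℝ) = √α₂ * √N := by rw [hn₂, Real.sqrt_mul hα₂.le]
  have hn₁0 : (0 : ℝ) < n₁ := by rw [hn₁]; positivity
  have hn₂0 : (0 : ℝ) < n₂ := by rw [hn₂]; positivity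
  set z₁ := coinScore n₁ k₁ with hz₁
  set z₂ := coinScore n₂ k₂ with hz₂
  set x := z₁ / (2 * (√α₁ * √N)) with hx
  set y := z₂ / (2 * (√α₂ * √N)) with hy
  have hk₁x : (k₁ : ℝ) = n₁ / 2 + n₁ * x := by
    rw [hx, ← hsqrt₁]
    exact eq_add_mul_coinScore hn₁0 k₁
  have hk₂y : (k₂ : ℝ) = n₂ / 2 + n₂ * y := by
    rw [hy, ← hsqrt₂]
    exact eq_add_mul_coinScore hn₂0 k₂
  have hfrac₁ : (k₁ : ℝ) / n₁ = 1 / 2 + x := by rw [hk₁x]; field_simp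
  have hfrac₂ : (k₂ : ℝ) / n₂ = 1 / 2 + y := by rw [hk₂y]; field_simp
  have hR0 : 0 ≤ R := (abs_nonneg _).trans hk₁
  -- The radius `ρ` contains both `1/√α₁` and `1/√α₂` so that it bounds both displacements at once.
  have hxρ : |x| ≤ ρ := by
    rw [hx, abs_div, abs_of_pos (by positivity : 0 < 2 * (√α₁ * √N)), hρ]
    calc |z₁| / (2 * (√α₁ * √N)) ≤ R / (√α₁ * √N) :=
          div_le_div₀ hR0 hk₁ (by positivity) (by linarith [mul_pos hs₁ hsN])
      _ = R * (1 / √α₁) / √N := by field_simp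
      _ ≤ R * (1 / √α₁ + 1 / √α₂) / √N := by
          gcongr
          linarith [one_div_pos.mpr hs₂]
  have hyρ : |y| ≤ ρ := by
    rw [hy, abs_div, abs_of_pos (by positivity : 0 < 2 * (√α₂ * √N)), hρ]
    calc |z₂| / (2 * (√α₂ * √N)) ≤ R / (√α₂ * √N) :=
          div_le_div₀ hR0 hk₂ (by positivity) (by linarith [mul_pos hs₂ hsN])
      _ = R * (1 / √α₂) / √N := by field_simp
      _ ≤ R * (1 / √α₁ + 1 / √α₂) / √N := by
          gcongr
          linarith [one_div_pos.mpr hs₁]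
  refine ⟨by rw [hfrac₁]; simpa using hxρ, by rw [hfrac₂]; simpa using hyρ, ?_⟩
  have hT := hM x y ρ hxρ hyρ hρ1
  rw [hfrac₁, hfrac₂]
  have hxx : N * x ^ 2 = z₁ ^ 2 / (4 * α₁) := by
    rw [hx, div_pow, mul_pow, mul_pow, Real.sq_sqrt hα₁.le, Real.sq_sqrt hN.le]
    field_simp
    norm_num
  have hyy : N * y ^ 2 = z₂ ^ 2 / (4 * α₂) := by
    rw [hy, div_pow, mul_pow, mul_pow, Real.sq_sqrt hα₂.le, Real.sq_sqrt hN.le]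
    field_simp
    norm_num
  have hxy : N * (x * y) = z₁ * z₂ / (4 * (√α₁ * √α₂)) := by
    rw [hx, hy, div_mul_div_comm]
    field_simp
    rw [Real.sq_sqrt hN.le]
    ring
  -- The linear terms cancel by `hJ₁` and `hJ₂`, leaving only the Taylor remainder of `f` scaled by
  -- `-πΓN`.
  have hsplit : -(Real.pi * F.Γ α₁) * (N * F.f (1 / 2 + x) (1 / 2 + y)) -
      Real.pi / 2 * (k₁ + k₂) -
      (-(Real.pi * F.Γ α₁) * (N * F.partialDeriv 0 0 (1 / 2) (1 / 2)) -
        Real.pi / 4 * (n₁ + n₂)) - F.limitPhase α₁ α₂ (z₁, z₂) =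
      -(Real.pi * F.Γ α₁) * N * (F.f (1 / 2 + x) (1 / 2 + y) -
        (F.partialDeriv 0 0 (1 / 2) (1 / 2) +
        F.partialDeriv 1 0 (1 / 2) (1 / 2) * x + F.partialDeriv 0 1 (1 / 2) (1 / 2) * y +
        (F.partialDeriv 2 0 (1 / 2) (1 / 2) * x ^ 2 / 2 +
          F.partialDeriv 1 1 (1 / 2) (1 / 2) * x * y +
          F.partialDeriv 0 2 (1 / 2) (1 / 2) * y ^ 2 / 2))) := by
    have hphase : F.limitPhase α₁ α₂ (z₁, z₂) =
        -(Real.pi * F.Γ α₁) * (F.partialDeriv 2 0 (1 / 2) (1 / 2) * (N * x ^ 2) / 2 +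
          F.partialDeriv 1 1 (1 / 2) (1 / 2) * (N * (x * y)) +
          F.partialDeriv 0 2 (1 / 2) (1 / 2) * (N * y ^ 2) / 2) := by
      rw [limitPhase, hxx, hyy, hxy]
      ring
    rw [hphase, hk₁x, hk₂y, hn₁, hn₂]
    linear_combination (-Real.pi * N * x) * hJ₁ + (-Real.pi * N * y) * hJ₂
  rw [hsplit, abs_mul, abs_mul, abs_neg, abs_of_pos hN]
  calc |Real.pi * F.Γ α₁| * N * _ ≤ |Real.pi * F.Γ α₁| * N * (M * ρ ^ 3) :=
        mul_le_mul_of_nonneg_left hT (by positivity)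
    _ = _ := by ring

end LeadingForm

end QAOA

/-! ### The limit of the success probability -/

open Filter Topology in
theorem theorem3
    -- the constant data: degree, leading-order polynomial, block proportions, locality bound
    (ℓ : ℕ) (hℓ : 1 ≤ ℓ) (F : QAOA.LeadingForm ℓ) (α₁ α₂ : ℝ) (hα₁ : 0 < α₁) (hα₂ : 0 < α₂)
    (hgrad : F.g₁ / α₁ = F.g₂ / α₂) (hgrad_ne : F.g₁ / α₁ ≠ 0)
    (hhess : (F.conditionMatrix α₁ α₂).det ≠ 0) (L : ℕ)
    -- the family of instances, with `n = n₁ + n₂ → ∞` and `n_i = α_i n`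
    (n₁ n₂ : ℕ → ℕ) (hn : Filter.Tendsto (fun m => n₁ m + n₂ m) Filter.atTop Filter.atTop)
    (hn₁ : ∀ m, (n₁ m : ℝ) = α₁ * ((n₁ m : ℝ) + n₂ m))
    (hn₂ : ∀ m, (n₂ m : ℝ) = α₂ * ((n₁ m : ℝ) + n₂ m))
    (s : (m : ℕ) → QAOA.BitString (Fin (n₁ m) ⊕ Fin (n₂ m)))
    (C : (m : ℕ) → QAOA.BitString (Fin (n₁ m) ⊕ Fin (n₂ m)) → ℝ)
    (hplanted : ∀ m, QAOA.IsPlanted (s m) (C m))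
    (hsymm : ∀ m, QAOA.IsSymmetricRel (QAOA.productSymmetry (n₁ m) (n₂ m)) (s m) (C m))
    (hlocal : ∀ m, QAOA.IsLocal L (C m))
    -- the cost is `n^ℓ f(k₁/n₁, k₂/n₂) + O(n^(ℓ-1))`, uniformly in the bit string
    (hform : ∃ K : ℝ, ∀ᶠ m in Filter.atTop, ∀ x : QAOA.BitString (Fin (n₁ m) ⊕ Fin (n₂ m)),
      |C m x - ((n₁ m : ℝ) + n₂ m) ^ ℓ *
          F.f ((QAOA.dist₁ x (s m) : ℝ) / n₁ m) ((QAOA.dist₂ x (s m) : ℝ) / n₂ m)|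
        ≤ K * ((n₁ m : ℝ) + n₂ m) ^ (ℓ - 1)) :
    let γ : ℕ → ℝ := fun m => -(F.Γ α₁ * Real.pi) / ((n₁ m : ℝ) + n₂ m) ^ (ℓ - 1)
    let P : ℕ → ℝ := fun m => QAOA.outcomeProb (C m) (-(Real.pi / 4)) (γ m) (s m)
    Asymptotics.IsTheta Filter.atTop γ (fun m => 1 / ((n₁ m : ℝ) + n₂ m) ^ (ℓ - 1)) ∧
    (∃ δ : ℝ, 0 < δ ∧ ∀ᶠ m in Filter.atTop, δ ≤ P m) ∧
    Filter.Tendsto P Filter.atTop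
      (nhds (16 * α₁ * α₂ / ‖(F.hessianS α₁ α₂).det‖)) := by
  intro γ P
  have hN : Tendsto (fun m => (n₁ m : ℝ) + n₂ m) atTop atTop := by
    refine (tendsto_natCast_atTop_atTop.comp hn).congr fun m => ?_
    simp
  have hNpos : ∀ᶠ m in atTop, (0 : ℝ) < (n₁ m : ℝ) + n₂ m := hN.eventually_gt_atTop 0
  have hn₁top : Tendsto n₁ atTop atTop := by
    rw [← tendsto_natCast_atTop_iff (R := ℝ)]
    exact (hN.const_mul_atTop hα₁).congr fun m => (hn₁ m).symm
  have hn₂top : Tendsto n₂ atTop atTop := by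
    rw [← tendsto_natCast_atTop_iff (R := ℝ)]
    exact (hN.const_mul_atTop hα₂).congr fun m => (hn₂ m).symm
  have hg : F.g₁ ≠ 0 := fun h => hgrad_ne (by rw [h, zero_div])
  have hlim : Tendsto P atTop (𝓝 (16 * α₁ * α₂ / ‖(F.hessianS α₁ α₂).det‖)) := by
    choose c hc hc₁ hc₂ using fun m => QAOA.exists_levelCost (hsymm m) (hlocal m)
    obtain ⟨K, hK⟩ := hform
    obtain ⟨A, hA0, hA⟩ := QAOA.exists_residual_lipschitz F L
    obtain ⟨M, hM0, hM⟩ := F.exists_phase_bound hα₁ hα₂ hg hgrad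
    -- After division by `n^{ℓ-1}` the error in the cost is bounded but need not tend to 0.
    have hresidual : ∀ᶠ m in atTop, ∀ k₁ ≤ n₁ m, ∀ k₂ ≤ n₂ m,
        |c m k₁ k₂ * (1 / ((n₁ m : ℝ) + n₂ m) ^ (ℓ - 1)) -
          ((n₁ m : ℝ) + n₂ m) * F.f ((k₁ : ℝ) / n₁ m) ((k₂ : ℝ) / n₂ m)| ≤ K := by
      filter_upwards [hK, hNpos] with m hm hpos k₁ hk₁ k₂ hk₂
      obtain ⟨x, rfl, rfl⟩ := QAOA.exists_dist_eq (s m) hk₁ hk₂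
      have h := hm x
      have hp : (0 : ℝ) < ((n₁ m : ℝ) + n₂ m) ^ (ℓ - 1) := pow_pos hpos _
      have hsucc : ((n₁ m : ℝ) + n₂ m) ^ ℓ =
          ((n₁ m : ℝ) + n₂ m) ^ (ℓ - 1) * ((n₁ m : ℝ) + n₂ m) := by
        rw [← pow_succ, Nat.sub_add_cancel hℓ]
      rw [hc m, hsucc] at h
      rw [← mul_le_mul_iff_left₀ hp]
      refine le_trans (le_of_eq ?_) h
      rw [← abs_of_pos hp, ← abs_mul, abs_of_pos hp]
      congr 1
      field_simp
    -- The reference phase includes the residual at the centre `(⌊n₁/2⌋, ⌊n₂/2⌋)`; the Lipschitz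
    -- bound then makes the residual's variation over the window small.
    have hphase : ∀ R > 0, ∀ ε > 0, ∀ᶠ m in atTop, ∀ k₁ ≤ n₁ m, ∀ k₂ ≤ n₂ m,
        |coinScore (n₁ m) k₁| ≤ R → |coinScore (n₂ m) k₂| ≤ R →
        |(γ m * c m k₁ k₂ - Real.pi / 2 * (k₁ + k₂)) -
          (-(Real.pi * F.Γ α₁) * (((n₁ m : ℝ) + n₂ m) * F.partialDeriv 0 0 (1 / 2) (1 / 2)) -
            Real.pi / 4 * (n₁ m + n₂ m) - Real.pi * F.Γ α₁ *
            (c m (n₁ m / 2) (n₂ m / 2) * (1 / ((n₁ m : ℝ) + n₂ m) ^ (ℓ - 1)) -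
              ((n₁ m : ℝ) + n₂ m) * F.f (((n₁ m / 2 : ℕ) : ℝ) / n₁ m)
                (((n₂ m / 2 : ℕ) : ℝ) / n₂ m))) -
          F.limitPhase α₁ α₂ (coinScore (n₁ m) k₁, coinScore (n₂ m) k₂)| ≤ ε := by
      intro R hR ε hε
      set ρ : ℕ → ℝ := fun m => R * (1 / √α₁ + 1 / √α₂) / √((n₁ m : ℝ) + n₂ m) with hρ
      have hsqrt : Tendsto (fun m => √((n₁ m : ℝ) + n₂ m)) atTop atTop :=
        Real.tendsto_sqrt_atTop.comp hN
      have hρ0 : Tendsto ρ atTop (𝓝 0) := hsqrt.const_div_atTop _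
      -- As `ρ` is of order `n^{-1/2}`, the Taylor error `nρ³` is too.
      have hcube : Tendsto (fun m => ((n₁ m : ℝ) + n₂ m) * ρ m ^ 3) atTop (𝓝 0) := by
        have h := hsqrt.const_div_atTop ((R * (1 / √α₁ + 1 / √α₂)) ^ 3)
        refine h.congr' ?_
        filter_upwards [hNpos] with m hpos
        have hs := Real.sqrt_pos.mpr hpos
        rw [hρ]
        simp only
        generalize R * (1 / √α₁ + 1 / √α₂) = q
        have e := Real.mul_self_sqrt hpos.le
        set w := √((n₁ m : ℝ) + n₂ m)
        rw [← e]
        field_simp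
      have hinv₁ : Tendsto (fun m => 1 / (n₁ m : ℝ)) atTop (𝓝 0) :=
        (tendsto_natCast_atTop_atTop.comp hn₁top).const_div_atTop 1
      have hinv₂ : Tendsto (fun m => 1 / (n₂ m : ℝ)) atTop (𝓝 0) :=
        (tendsto_natCast_atTop_atTop.comp hn₂top).const_div_atTop 1
      have herr : Tendsto (fun m => M * (((n₁ m : ℝ) + n₂ m) * ρ m ^ 3) +
          |Real.pi * F.Γ α₁| * (A * K * ((ρ m + 1 / (n₁ m : ℝ)) + (ρ m + 1 / (n₂ m : ℝ)))))
          atTop (𝓝 0) := by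
        simpa using (hcube.const_mul M).add
          ((((hρ0.add hinv₁).add (hρ0.add hinv₂)).const_mul (A * K)).const_mul
            |Real.pi * F.Γ α₁|)
      filter_upwards [hresidual, hNpos, herr.eventually_le_const hε,
        hρ0.eventually_le_const one_pos, hn₁top.eventually_ge_atTop (L + ℓ + 1),
        hn₂top.eventually_ge_atTop (L + ℓ + 1)]
        with m hres hpos hle hρ1 hm₁ hm₂ k₁ hk₁ k₂ hk₂ hz₁ hz₂
      obtain ⟨hx, hy, hT⟩ := hM hpos (hn₁ m) (hn₂ m) rfl hρ1 k₁ k₂ hz₁ hz₂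
      have hK0 : 0 ≤ K := (abs_nonneg _).trans (hres k₁ hk₁ k₂ hk₂)
      -- The term `1/n` accounts for rounding `n/2` down.
      have hcenter : ∀ n k : ℕ, 1 ≤ n → |(k : ℝ) / n - 1 / 2| ≤ ρ m →
          |(k : ℝ) - ((n / 2 : ℕ) : ℝ)| / n ≤ ρ m + 1 / n := by
        intro n k h1 hk
        have hn0 : (0 : ℝ) < n := by exact_mod_cast h1
        have h2 : |(n : ℝ) / 2 - ((n / 2 : ℕ) : ℝ)| ≤ 1 := by
          have e1 : n / 2 * 2 ≤ n := Nat.div_mul_le_self n 2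
          have e2 : n ≤ n / 2 * 2 + 1 := by omega
          have e1' : ((n / 2 : ℕ) : ℝ) * 2 ≤ n := by exact_mod_cast e1
          have e2' : (n : ℝ) ≤ ((n / 2 : ℕ) : ℝ) * 2 + 1 := by exact_mod_cast e2
          rw [abs_le]
          constructor <;> linarith
        have h3 : |(k : ℝ) - n / 2| = |(k : ℝ) / n - 1 / 2| * n := by
          rw [← abs_of_pos hn0, ← abs_mul, abs_of_pos hn0]
          congr 1
          field_simp
        rw [div_le_iff₀ hn0, add_mul, one_div_mul_cancel hn0.ne']
        refine (abs_sub_le _ ((n : ℝ) / 2) _).trans (add_le_add ?_ h2)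
        rw [h3]
        exact mul_le_mul_of_nonneg_right hk hn0.le
      have hLip := hA hm₁ hm₂ (hc₁ m) (hc₂ m) hres k₁ hk₁ k₂ hk₂ (n₁ m / 2)
        (Nat.div_le_self _ _) (n₂ m / 2) (Nat.div_le_self _ _)
      have hd := add_le_add (hcenter (n₁ m) k₁ (by omega) hx) (hcenter (n₂ m) k₂ (by omega) hy)
      have hLip' := hLip.trans (mul_le_mul_of_nonneg_left hd (mul_nonneg hA0 hK0))
      have hLip'' := mul_le_mul_of_nonneg_left hLip' (abs_nonneg (-(Real.pi * F.Γ α₁)))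
      rw [← abs_mul, abs_neg] at hLip''
      refine le_trans ?_ ((add_le_add hT hLip'').trans hle)
      refine le_trans (le_of_eq ?_) (abs_add_le _ _)
      congr 1
      simp only [γ]
      ring
    have hnorm := tendsto_norm_sum_coinWeight_cexp hn₁top hn₂top
      (F.continuous_limitPhase α₁ α₂) hphase
    have hsq := hnorm.pow 2
    rw [F.norm_integral_limitPhase hα₁ hα₂] at hsq
    refine hsq.congr fun m => ?_
    simp only [P, QAOA.outcomeProb]
    rw [QAOA.state_quarter_eq_sum_coinWeight (hc m)]
  have hlim_pos : 0 < 16 * α₁ * α₂ / ‖(F.hessianS α₁ α₂).det‖ :=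
    div_pos (by positivity) (F.norm_det_hessianS_pos hα₁ hα₂)
  -- Half of the positive limit serves as the eventual lower bound.
  refine ⟨?_, ⟨16 * α₁ * α₂ / ‖(F.hessianS α₁ α₂).det‖ / 2, by positivity,
    hlim.eventually_const_le (by linarith)⟩, hlim⟩
  have hΓ : F.Γ α₁ ≠ 0 :=
    div_ne_zero (neg_ne_zero.mpr (mul_ne_zero (zpow_ne_zero _ two_ne_zero) hα₁.ne')) hg
  have hγ : γ = fun m => -(F.Γ α₁ * Real.pi) * (1 / ((n₁ m : ℝ) + n₂ m) ^ (ℓ - 1)) := by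
    ext m
    rw [mul_one_div]
  rw [hγ]
  exact (Asymptotics.isTheta_const_mul_left
    (neg_ne_zero.mpr (mul_ne_zero hΓ Real.pi_ne_zero))).mpr Asymptotics.isTheta_rfl
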